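/- **Setting.** There are $K$ arms, a finite nonempty set $E$ of experts and $T$ rounds, with $|E|T\ge 2$; $\Delta_K$ is the probability simplex in $\mathbb{R}^K$. In round $t=1,\dots,T$ the player receives advices $\xi_t^e\in\Delta_K$ ($e\in E$) and selects $p_t\in\Delta_K$, the adversary selects $\ell_t\in[0,1]^K$, and an arm $a_t$ is drawn from $p_t$, conditionally on everything so far (advices and losses may be random and may depend on the past). The player observes only $\ell_t(a_t)$. The regret is $R_T=\max_{e\in E}\mathbb{E}\sum_{t=1}^T\big(\ell_t(a_t)-\langle\xi_t^e,\ell_t\rangle\big)$. **Truncation.** For a set $A$ of arms, $s\in\mathbb{R}$ and $q\in\Delta_K$, let $\mathcal{T}_s^Aq(i)=q(i)\Big(1+\frac{\sum_{j\notin A,\,q(j)\le s}q(j)}{\sum_{j\in A}q(j)}\Big)$ for $i\in A$; for $i\notin A$ let $\mathcal{T}_s^Aq(i)=0$ if $q(i)\le s$ and $\mathcal{T}_s^Aq(i)=q(i)$ if $q(i)>s$. **The algorithm MYGA** has a learning rate $\eta>0$ and a threshold $\gamma\in\{\frac1{2T},\frac2{2T},\frac3{2T},\dots\}$. Let $S=(\gamma,\frac12]\cap\{\frac1{2T},\frac2{2T},\dots\}$.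 In round $t$, let $w_t(e)=\exp\big(-\eta\sum_{r<t}\langle\xi_r^e,\tilde\ell_r\rangle\big)$ for $e\in E\cup S$, where $\tilde\ell_r(i)=\frac{\ell_r(i)}{p_r(i)}\mathbf{1}_{i=a_r}$. Let $\zeta_t=\sum_{e\in E}w_t(e)\xi_t^e\big/\sum_{e\in E}w_t(e)$, order the arms by nonincreasing $\zeta_t$ (ties broken arbitrarily), and let $A_t$ be the set of the first $k_t$ arms, where $k_t$ is the smallest number of leading arms with total $\zeta_t$-mass at least $\frac12$. Find $q_t\in\Delta_K$ with $$q_t=\frac{\sum_{e\in E}w_t(e)\,\xi_t^e+\sum_{s\in S}w_t(s)\,\mathcal{T}_s^{A_t}q_t}{\sum_{e\in E}w_t(e)+\sum_{s\in S}w_t(s)},$$ set $\xi_t^s=\mathcal{T}_s^{A_t}q_t$ for $s\in S$, and play from $p_t=\mathcal{T}_\gamma^{A_t}q_t$. **Theorem.** The equation for $q_t$ always has a solution. Moreover, there are universal constants $c_0,\kappa>0$ such that for all constants $0<a\le b$ and $c_0\le c\le d$ with $bd\le\kappa$ there is a constant $C>0$, depending only on $a,b,c,d$, with the following property. Let $L^*$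 be such that $\min_{e\in E}\mathbb{E}\sum_{t=1}^T\langle\xi_t^e,\ell_t\rangle\le L^*$, put $\rho=\min\Big\{\frac1K,\sqrt{\frac{\log(|E|T)}{KL^*}}\Big\}$ (so $\rho=\frac1K$ if $L^*=0$), and let MYGA be run with any $\eta$ and any admissible $\gamma$ satisfying $$a\rho\le\eta\le b\rho\qquad\text{and}\qquad c\,\eta\le\gamma\le d\,\eta+\tfrac1{2T}$$ (that is, $\eta=\Theta(\rho)$ and $\gamma=\Theta(\eta)$ up to one step of the grid), and with any choice of the solutions $q_t$. Then $$R_T\le C\Big(\sqrt{K\log(|E|T)\,L^*}+K\log(|E|T)\Big).$$ -/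

import Mathlib

open MeasureTheory ProbabilityTheory

noncomputable section

/-- One play of the contextual bandit game with `K` arms, expert set `E` and `T` rounds, as a family
of random variables on a probability space.  The σ-algebra `info t` is everything that is determined
just before the action of round `t` is drawn: the past actions, and the advices, the player's
distribution and the loss function of round `t`.  Advices and losses may thus be random and may
depend in any way on the past (adaptive adversary). -/
structure BanditGame {Ω : Type*} [m : MeasurableSpace Ω] (μ : Measure Ω) (E : Type*) (K T : ℕ) where
  /-- the information available just before the action of round `t` is drawn -/
  info : Filtration (Fin T) m
  /-- the advice of an expert in round `t` -/
  advice : Fin T → E → Ω → Fin K → ℝ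
  /-- the loss function of round `t` -/
  loss : Fin T → Ω → Fin K → ℝ
  /-- the distribution selected by the player in round `t` -/
  play : Fin T → Ω → Fin K → ℝ
  /-- the action played in round `t` -/
  action : Fin T → Ω → Fin K
  advice_mem : ∀ t e ω, advice t e ω ∈ stdSimplex ℝ (Fin K)
  loss_mem : ∀ t ω i, loss t ω i ∈ Set.Icc (0 : ℝ) 1
  play_mem : ∀ t ω, play t ω ∈ stdSimplex ℝ (Fin K)
  measurable_advice : ∀ t e, Measurable[info t] (advice t e)
  measurable_loss : ∀ t, Measurable[info t] (loss t)
  measurable_play : ∀ t, Measurable[info t] (play t)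
  measurable_action : ∀ t, Measurable (action t)
  measurable_past_action : ∀ r t, r < t → Measurable[info t] (action r)
  /-- the action of round `t` is drawn from `play t`, independently of the past -/
  action_law : ∀ t i,
    μ[Set.indicator {ω | action t ω = i} (fun _ => (1 : ℝ)) | info t] =ᵐ[μ] fun ω => play t ω i

namespace BanditGame

/-- The regret against the best expert. -/
def regret {Ω : Type*} [MeasurableSpace Ω] {μ : Measure Ω} {E : Type*} {K T : ℕ}
    (G : BanditGame μ E K T) : ℝ :=
  ⨆ e : E, ∫ ω, ∑ t, (G.loss t ω (G.action t ω) - dotProduct (G.advice t e ω) (G.loss t ω)) ∂μ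

/-- The expected cumulative loss of the best expert. -/
def bestExpertLoss {Ω : Type*} [MeasurableSpace Ω] {μ : Measure Ω} {E : Type*} {K T : ℕ}
    (G : BanditGame μ E K T) : ℝ :=
  ⨅ e : E, ∫ ω, ∑ t, dotProduct (G.advice t e ω) (G.loss t ω) ∂μ

/-- The importance weighted loss estimator of round `t`. -/
def lossEstimator {Ω : Type*} [MeasurableSpace Ω] {μ : Measure Ω} {E : Type*} {K T : ℕ}
    (G : BanditGame μ E K T) (t : Fin T) (ω : Ω) (i : Fin K) : ℝ :=
  if i = G.action t ω then G.loss t ω i / G.play t ω i else 0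

/-- The exponential weight, at the start of round `t`, of an expert with advices `ξ`; in the first
round it is `1`. -/
def expWeight {Ω : Type*} [MeasurableSpace Ω] {μ : Measure Ω} {E : Type*} {K T : ℕ}
    (G : BanditGame μ E K T) (η : ℝ) (ξ : Fin T → Ω → Fin K → ℝ) (t : Fin T) (ω : Ω) : ℝ :=
  Real.exp (-η * ∑ r ∈ Finset.Iio t, dotProduct (ξ r ω) (G.lossEstimator r ω))

end BanditGame

namespace MYGA

/-- The truncation operator with threshold `s`, where `A` is the set of majority arms. -/
def truncate {K : ℕ} (A : Finset (Fin K)) (s : ℝ) (q : Fin K → ℝ) (i : Fin K) : ℝ :=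
  if i ∈ A then
    q i * (1 + (∑ j with j ∉ A ∧ q j ≤ s, q j) / ∑ j ∈ A, q j)
  else if q i ≤ s then 0 else q i

/-- The grid `{1/(2T), 2/(2T), 3/(2T), …}`. -/
def grid (T : ℕ) : Set ℝ := {x | ∃ n : ℕ, 1 ≤ n ∧ x = n / (2 * T)}

/-- The thresholds of the auxiliary experts: the points of the grid in `(γ, 1/2]`. -/
def thresholds (T : ℕ) (γ : ℝ) : Finset ℝ :=
  {s ∈ (Finset.Icc 1 T).image (fun n : ℕ => (n : ℝ) / (2 * T)) | γ < s}

theorem mem_thresholds (T : ℕ) (hT : 0 < T) (γ s : ℝ) :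
    s ∈ thresholds T γ ↔ s ∈ Set.Ioc γ (1 / 2) ∩ grid T := by
  have hT' : (0 : ℝ) < T := by exact_mod_cast hT
  simp only [thresholds, grid, Finset.mem_filter, Finset.mem_image, Finset.mem_Icc, Set.mem_inter_iff,
    Set.mem_Ioc, Set.mem_ofPred_eq]
  constructor
  · rintro ⟨⟨n, ⟨h1, h2⟩, rfl⟩, h3⟩
    have h2' : (n : ℝ) ≤ T := by exact_mod_cast h2
    refine ⟨⟨h3, ?_⟩, n, h1, rfl⟩
    rw [div_le_div_iff₀ (by positivity) (by norm_num)]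
    linarith
  · rintro ⟨⟨h3, h4⟩, n, h1, rfl⟩
    rw [div_le_div_iff₀ (by positivity) (by norm_num)] at h4
    refine ⟨⟨n, ⟨h1, ?_⟩, rfl⟩, h3⟩
    have : (n : ℝ) ≤ T := by linarith
    exact_mod_cast this

/-- The weighted average of the advices `ξ` with weights `u`. -/
def weightedAverage {E : Type*} [Fintype E] {K : ℕ} (u : E → ℝ) (ξ : E → Fin K → ℝ) : Fin K → ℝ :=
  (∑ e, u e)⁻¹ • ∑ e, u e • ξ e

/-- `σ` lists the arms in nonincreasing order of `ζ`. -/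
def Sorts {K : ℕ} (σ : Equiv.Perm (Fin K)) (ζ : Fin K → ℝ) : Prop :=
  Antitone fun i => ζ (σ i)

/-- `k` is the first position at which the mass of `ζ`, read in the order `σ`, reaches `1/2`. -/
def IsPivot {K : ℕ} (σ : Equiv.Perm (Fin K)) (ζ : Fin K → ℝ) (k : Fin K) : Prop :=
  IsLeast {i : Fin K | 1 / 2 ≤ ∑ j ∈ Finset.Iic i, ζ (σ j)} k

/-- The majority arms: those in the positions up to `k` in the order `σ`. -/
def majority {K : ℕ} (σ : Equiv.Perm (Fin K)) (k : Fin K) : Finset (Fin K) :=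
  {i | σ.symm i ≤ k}

/-- `q` is a distribution that equals the weighted average of the advices `ξ` (with weights `u`) and
of its own truncations at the thresholds `s ∈ S` (with weights `v`). -/
def IsMixture {E : Type*} [Fintype E] {K : ℕ} (u : E → ℝ) (ξ : E → Fin K → ℝ) (S : Finset ℝ)
    (v : ℝ → ℝ) (A : Finset (Fin K)) (q : Fin K → ℝ) : Prop :=
  q ∈ stdSimplex ℝ (Fin K) ∧
    q = (∑ e, u e + ∑ s ∈ S, v s)⁻¹ • (∑ e, u e • ξ e + ∑ s ∈ S, v s • truncate A s q)

/-- In the game `G` the player follows the algorithm with learning rate `η` and threshold `γ`.  In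
round `t` the arms are sorted by `order t` (ties are broken arbitrarily), `pivot t` is the pivot
index, and `q t` is the solution of the implicit equation that the algorithm found (any solution is
allowed). -/
structure IsRun {Ω : Type*} [MeasurableSpace Ω] {μ : Measure Ω} {E : Type*} [Fintype E] {K T : ℕ}
    (G : BanditGame μ E K T) (η γ : ℝ) (order : Fin T → Ω → Equiv.Perm (Fin K))
    (pivot : Fin T → Ω → Fin K) (q : Fin T → Ω → Fin K → ℝ) : Prop where
  eta_pos : 0 < η
  gamma_mem : γ ∈ grid T
  measurable_order : ∀ t σ, MeasurableSet[G.info t] {ω | order t ω = σ}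
  measurable_q : ∀ t, Measurable[G.info t] (q t)
  sorts : ∀ t ω, Sorts (order t ω)
    (weightedAverage (fun e => G.expWeight η (fun r => G.advice r e) t ω) (fun e => G.advice t e ω))
  isPivot : ∀ t ω, IsPivot (order t ω)
    (weightedAverage (fun e => G.expWeight η (fun r => G.advice r e) t ω) (fun e => G.advice t e ω))
    (pivot t ω)
  isMixture : ∀ t ω, IsMixture
    (fun e => G.expWeight η (fun r => G.advice r e) t ω) (fun e => G.advice t e ω)
    (thresholds T γ)
    (fun s => G.expWeight η
      (fun r ω => truncate (majority (order r ω) (pivot r ω)) s (q r ω)) t ω)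
    (majority (order t ω) (pivot t ω)) (q t ω)
  play_eq : ∀ t ω, G.play t ω = truncate (majority (order t ω) (pivot t ω)) γ (q t ω)

/-- The scale `min {1/K, √(log (N T) / (K L))}` of the learning rate, for `N` experts; for `L = 0`
the second term is read as `+∞`. -/
def rateScale (K N T : ℕ) (L : ℝ) : ℝ :=
  if L = 0 then 1 / K else min (1 / (K : ℝ)) (√(Real.log (N * T) / (K * L)))

end MYGA

end

/-! ### Solvability of the implicit equation -/

namespace MYGA

/-! MYGA is exponential weights over `E` together with the truncating experts, and the implicit
equation says that the weighted average of all advices is q_t. The second-order analysis bounds the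
expected estimated regret against every expert, auxiliary ones included, by R = log(|E| + T)/η +
(η/2)V, where V is the expected sum of q_t(i) ℓ_t(i)²/p_t(i) over the arms with p_t(i) > 0. A
first-order bound needs V to be controlled by K times the expected estimated loss Z of q_t. On
majority arms q_t ≥ 1/(2K), which suffices. A played minority arm, however, contributes ℓ_t(i)²
without a factor q_t(i), and this could be far larger than its share of Z.

The auxiliary experts remove this obstacle. Expert s avoids the minority arms with q_t(i) ≤ s and
pays by a slight inflation of the majority arms; since its advantage over q_t is at most R, the
losses q_t(i) ℓ_t(i) of the arms with γ < q_t(i) ≤ s are small up to that inflation. Averaging over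
s with weights α_s such that the weights above x sum to about 1/x (`exists_threshold_weights`) turns
q_t(i) ℓ_t(i) into ℓ_t(i). The inflation costs O(KZ) in total and the weights sum to at most 1/γ, so
V ≤ 6KZ + 2R/γ (via `sum_truncate_mul_sq_le`). Hence R ≤ log(|E| + T)/η + 3ηKZ + (η/γ)R, and γ ≥ 2η
absorbs the last term.

Playing p_t instead of q_t costs a factor 1 + 2Kγ, and Z ≤ L* + R because the estimator never
overestimates in expectation (`exists_regret_le`). The choice η ≈ ρ balances the terms
(`regret_le_of_rate`).

The implicit equation is solvable because it decouples: each minority arm satisfies a scalar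
equation of its own, and the majority arms are a common multiple of ζ_t (`exists_isMixture`). -/

theorem exists_nonneg_mul_add_sum_eq (S : Finset ℝ) (v : ℝ → ℝ) (hv : ∀ s ∈ S, 0 < v s)
    {U y : ℝ} (hU : 0 < U) (hy : 0 ≤ y) :
    ∃ x, 0 ≤ x ∧ x * (U + ∑ s ∈ S with x ≤ s, v s) = y := by
  -- As a function of x, the left side is left-continuous, increases between thresholds and jumps
  -- only downward, so it skips no value on its way up. In the induction on the smallest threshold
  -- s₀, a solution above s₀ survives; for one at most s₀ every threshold counts, and enlarging the
  -- divisor keeps the new solution below s₀.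
  induction S using Finset.induction_on_min with
  | empty => exact ⟨y / U, by positivity, by simp; field_simp⟩
  | insert s₀ S hlt ih =>
    obtain ⟨x, hx, hxy⟩ := ih fun s hs => hv s (Finset.mem_insert_of_mem hs)
    have hs₀ : s₀ ∉ S := fun h => lt_irrefl _ (hlt _ h)
    have hv₀ : 0 < v s₀ := hv _ (Finset.mem_insert_self _ _)
    have hall : ∀ z, z ≤ s₀ → ∑ s ∈ S with z ≤ s, v s = ∑ s ∈ S, v s := fun z hz => by
      rw [Finset.filter_true_of_mem fun s hs => hz.trans (hlt s hs).le]
    rcases lt_or_ge s₀ x with h | h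
    · exact ⟨x, hx, by rw [Finset.filter_insert, if_neg (not_le.2 h), hxy]⟩
    · have hV : 0 ≤ ∑ s ∈ S, v s :=
        Finset.sum_nonneg fun s hs => (hv s (Finset.mem_insert_of_mem hs)).le
      rw [hall x h] at hxy
      have hle : y / (U + (v s₀ + ∑ s ∈ S, v s)) ≤ s₀ := by
        refine le_trans ?_ h
        rw [div_le_iff₀ (by positivity), ← hxy]
        nlinarith [mul_nonneg hx hv₀.le]
      refine ⟨y / (U + (v s₀ + ∑ s ∈ S, v s)), by positivity, ?_⟩
      rw [Finset.filter_insert, if_pos hle, Finset.sum_insert (by simp [hs₀]), hall _ hle]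
      field_simp

variable {K : ℕ}

theorem sum_truncate (A : Finset (Fin K)) (s : ℝ) (q : Fin K → ℝ) (hA : ∑ j ∈ A, q j ≠ 0) :
    ∑ i, truncate A s q i = ∑ i, q i := by
  have h1 : ∀ f : Fin K → ℝ, ∑ i, f i = ∑ i ∈ A, f i + ∑ i ∈ Aᶜ, f i := fun f =>
    (Finset.sum_add_sum_compl A f).symm
  rw [h1, h1]
  have h2 : ∑ i ∈ A, truncate A s q i
      = ∑ i ∈ A, q i + ∑ j with j ∉ A ∧ q j ≤ s, q j := by
    rw [Finset.sum_congr rfl fun i hi => (by rw [truncate, if_pos hi] :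
      truncate A s q i = q i * (1 + (∑ j with j ∉ A ∧ q j ≤ s, q j) / ∑ j ∈ A, q j)),
      ← Finset.sum_mul]
    field_simp
  have h3 : ∑ j with j ∉ A ∧ q j ≤ s, q j = ∑ j ∈ Aᶜ, if q j ≤ s then q j else 0 := by
    rw [← Finset.sum_filter]
    congr 1
    ext j
    simp
  rw [h2, h3, add_assoc, ← Finset.sum_add_distrib]
  congr 1
  refine Finset.sum_congr rfl fun i hi => ?_
  rw [truncate, if_neg (Finset.mem_compl.1 hi)]
  split_ifs <;> simp

theorem truncate_nonneg {A : Finset (Fin K)} {s : ℝ} {q : Fin K → ℝ} (hq : ∀ i, 0 ≤ q i)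
    (i : Fin K) : 0 ≤ truncate A s q i := by
  have h1 : 0 ≤ ∑ j with j ∉ A ∧ q j ≤ s, q j := Finset.sum_nonneg fun j _ => hq j
  have h2 : 0 ≤ ∑ j ∈ A, q j := Finset.sum_nonneg fun j _ => hq j
  have := hq i
  unfold truncate
  split_ifs <;> positivity

theorem le_truncate_of_mem {A : Finset (Fin K)} {s : ℝ} {q : Fin K → ℝ} (hq : ∀ i, 0 ≤ q i)
    {i : Fin K} (hi : i ∈ A) : q i ≤ truncate A s q i := by
  have h1 : 0 ≤ ∑ j with j ∉ A ∧ q j ≤ s, q j := Finset.sum_nonneg fun j _ => hq j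
  have h2 : 0 ≤ ∑ j ∈ A, q j := Finset.sum_nonneg fun j _ => hq j
  rw [truncate, if_pos hi]
  exact le_mul_of_one_le_right (hq i) (by linarith [div_nonneg h1 h2])

theorem truncate_mem_stdSimplex {A : Finset (Fin K)} (s : ℝ) {q : Fin K → ℝ}
    (hq : q ∈ stdSimplex ℝ (Fin K)) (hA : ∑ j ∈ A, q j ≠ 0) :
    truncate A s q ∈ stdSimplex ℝ (Fin K) :=
  ⟨truncate_nonneg hq.1, by rw [sum_truncate A s q hA, hq.2]⟩

theorem sum_majority (σ : Equiv.Perm (Fin K)) (k : Fin K) (f : Fin K → ℝ) :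
    ∑ i ∈ majority σ k, f i = ∑ j ∈ Finset.Iic k, f (σ j) := by
  refine (Finset.sum_bij (fun j _ => σ j) ?_ ?_ ?_ ?_).symm
  · intro j hj
    simpa [majority] using hj
  · intro i _ j _ h
    exact σ.injective h
  · intro i hi
    exact ⟨σ.symm i, by simpa [majority] using hi, by simp⟩
  · intro i _
    rfl

/-- The arms before the pivot carry less than 1/2, so the pivot and its successors, at most `K` arms
and none heavier than the pivot, carry more than 1/2. -/
theorem inv_le_of_mem_majority {σ : Equiv.Perm (Fin K)} {ζ : Fin K → ℝ} {k : Fin K}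
    (hζ : ζ ∈ stdSimplex ℝ (Fin K)) (hσ : Sorts σ ζ) (hk : IsPivot σ ζ k) {i : Fin K}
    (hi : i ∈ majority σ k) : 1 / (2 * (K : ℝ)) ≤ ζ i := by
  have hK : (0 : ℝ) < K := by exact_mod_cast k.pos
  have hik : ζ (σ k) ≤ ζ i := by
    have := hσ (show σ.symm i ≤ k by simpa [majority] using hi)
    simpa using this
  refine le_trans ?_ hik
  by_contra! hlt
  have hhead : ∑ j ∈ Finset.Iio k, ζ (σ j) < 1 / 2 := by
    by_contra! h
    have hk0 : 0 < (k : ℕ) := by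
      by_contra! h0
      have : Finset.Iio k = ∅ := by
        ext j
        simp only [Finset.mem_Iio, Fin.lt_def, Finset.notMem_empty, iff_false]
        omega
      rw [this, Finset.sum_empty] at h
      norm_num at h
    have hIio : Finset.Iio k = Finset.Iic (⟨k - 1, by omega⟩ : Fin K) := by
      ext j
      simp only [Finset.mem_Iio, Finset.mem_Iic, Fin.lt_def, Fin.le_def]
      omega
    rw [hIio] at h
    have := hk.2 h
    simp only [Fin.le_def] at this
    omega
  have hsplit : ∑ j ∈ Finset.Iio k, ζ (σ j) + ∑ j ∈ (Finset.Iio k)ᶜ, ζ (σ j) = 1 := by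
    rw [Finset.sum_add_sum_compl, Equiv.sum_comp σ ζ, hζ.2]
  have htail : ∑ j ∈ (Finset.Iio k)ᶜ, ζ (σ j) ≤ K * (1 / (2 * (K : ℝ))) := by
    have h1 : ∑ j ∈ (Finset.Iio k)ᶜ, ζ (σ j) ≤ ∑ j ∈ (Finset.Iio k)ᶜ, 1 / (2 * (K : ℝ)) :=
      Finset.sum_le_sum fun j hj => (hσ (by simpa using hj)).trans hlt.le
    refine h1.trans ?_
    rw [Finset.sum_const, nsmul_eq_mul]
    have : ((Finset.Iio k)ᶜ.card : ℝ) ≤ K := by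
      exact_mod_cast (Finset.card_le_univ _).trans (by simp)
    gcongr
  have : (K : ℝ) * (1 / (2 * (K : ℝ))) = 1 / 2 := by field_simp
  linarith

section Mixture

variable {E : Type*} [Fintype E] {u : E → ℝ} {ξ : E → Fin K → ℝ}

theorem sum_mul_eq_weightedAverage (hU : ∑ e, u e ≠ 0) (i : Fin K) :
    ∑ e, u e * ξ e i = (∑ e, u e) * weightedAverage u ξ i := by
  simp only [weightedAverage, Pi.smul_apply, Finset.sum_apply, smul_eq_mul]
  field_simp

theorem weightedAverage_mem_stdSimplex (hu : ∀ e, 0 ≤ u e) (hU : 0 < ∑ e, u e)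
    (hξ : ∀ e, ξ e ∈ stdSimplex ℝ (Fin K)) : weightedAverage u ξ ∈ stdSimplex ℝ (Fin K) := by
  refine ⟨fun i => ?_, ?_⟩
  · simp only [weightedAverage, Pi.smul_apply, Finset.sum_apply, smul_eq_mul]
    exact mul_nonneg (inv_nonneg.2 hU.le)
      (Finset.sum_nonneg fun e _ => mul_nonneg (hu e) ((hξ e).1 i))
  · simp only [weightedAverage, Pi.smul_apply, Finset.sum_apply, smul_eq_mul]
    rw [← Finset.mul_sum, Finset.sum_comm]
    simp only [← Finset.mul_sum, (hξ _).2, mul_one]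
    field_simp

theorem mixture_apply {S : Finset ℝ} {v : ℝ → ℝ} {A : Finset (Fin K)} {q : Fin K → ℝ}
    (h : IsMixture u ξ S v A q) (hW : ∑ e, u e + ∑ s ∈ S, v s ≠ 0) (i : Fin K) :
    (∑ e, u e + ∑ s ∈ S, v s) * q i
      = ∑ e, u e * ξ e i + ∑ s ∈ S, v s * truncate A s q i := by
  have := congrFun h.2 i
  simp only [Pi.smul_apply, Pi.add_apply, Finset.sum_apply, smul_eq_mul] at this
  conv_lhs => rw [this]
  field_simp

/-- Truncation never lowers a majority arm, so the auxiliary terms of the equation contribute at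
least their total weight times `q i`. -/
theorem weightedAverage_le_mixture {S : Finset ℝ} {v : ℝ → ℝ} {A : Finset (Fin K)}
    {q : Fin K → ℝ} (h : IsMixture u ξ S v A q) (hU : 0 < ∑ e, u e) (hv : ∀ s ∈ S, 0 ≤ v s)
    {i : Fin K} (hi : i ∈ A) : weightedAverage u ξ i ≤ q i := by
  have hV : 0 ≤ ∑ s ∈ S, v s := Finset.sum_nonneg hv
  have h1 := mixture_apply h (by positivity) i
  rw [sum_mul_eq_weightedAverage hU.ne'] at h1
  have h2 : (∑ s ∈ S, v s) * q i ≤ ∑ s ∈ S, v s * truncate A s q i := by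
    rw [Finset.sum_mul]
    exact Finset.sum_le_sum fun s hs =>
      mul_le_mul_of_nonneg_left (le_truncate_of_mem h.1.1 hi) (hv s hs)
  refine le_of_mul_le_mul_left ?_ hU
  linarith

/-- For i ∉ A the equation involves `q i` alone: q(i) (U + ∑_{s ≥ q(i)} v(s)) = U ζ(i). On A the
ansatz q = λζ reduces it to Uλ = U + D/Z, where D is the `v`-weighted mass moved from the minority
and Z = ζ(A). -/
theorem exists_isMixture [Nonempty E] (S : Finset ℝ) (v : ℝ → ℝ) (A : Finset (Fin K))
    (hu : ∀ e, 0 < u e) (hv : ∀ s ∈ S, 0 < v s) (hξ : ∀ e, ξ e ∈ stdSimplex ℝ (Fin K))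
    (hA : 0 < ∑ i ∈ A, weightedAverage u ξ i) : ∃ q, IsMixture u ξ S v A q := by
  have hU : 0 < ∑ e, u e := Finset.sum_pos (fun e _ => hu e) Finset.univ_nonempty
  have hV : 0 ≤ ∑ s ∈ S, v s := Finset.sum_nonneg fun s hs => (hv s hs).le
  have hζ := weightedAverage_mem_stdSimplex (fun e => (hu e).le) hU hξ
  have hmul := sum_mul_eq_weightedAverage (ξ := ξ) hU.ne'
  set ζ := weightedAverage u ξ
  set U := ∑ e, u e
  choose x hx0 hx using fun i : Fin K =>
    exists_nonneg_mul_add_sum_eq S v hv hU (mul_nonneg hU.le (hζ.1 i))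
  set Z := ∑ i ∈ A, ζ i
  set m : ℝ → ℝ := fun s => ∑ j with j ∉ A ∧ x j ≤ s, x j
  have hm : ∀ s, 0 ≤ m s := fun s => Finset.sum_nonneg fun j _ => hx0 j
  set D := ∑ s ∈ S, v s * m s with hD
  have hD0 : 0 ≤ D := Finset.sum_nonneg fun s hs => mul_nonneg (hv s hs).le (hm s)
  set lam := 1 + D / (U * Z) with hlam
  have hlam0 : 0 < lam := by positivity
  set q : Fin K → ℝ := fun i => if i ∈ A then ζ i * lam else x i with hq
  have hqA : ∑ j ∈ A, q j = Z * lam := by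
    rw [Finset.sum_mul]
    exact Finset.sum_congr rfl fun i hi => by simp only [hq, if_pos hi]
  have hqm : ∀ s, ∑ j with j ∉ A ∧ q j ≤ s, q j = m s := fun s => by
    have hne : ∀ j ∉ A, q j = x j := fun j hj => by simp only [hq, if_neg hj]
    have hset : Finset.univ.filter (fun j => j ∉ A ∧ q j ≤ s)
        = Finset.univ.filter (fun j => j ∉ A ∧ x j ≤ s) := by
      ext j
      simp only [Finset.mem_filter, Finset.mem_univ, true_and]
      exact and_congr_right fun hj => by rw [hne j hj]
    rw [hset]
    exact Finset.sum_congr rfl fun j hj => hne j (Finset.mem_filter.1 hj).2.1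
  have heq : ∀ i, (U + ∑ s ∈ S, v s) * q i
      = ∑ e, u e * ξ e i + ∑ s ∈ S, v s * truncate A s q i := fun i => by
    rw [hmul]
    by_cases hi : i ∈ A
    · have hqi : q i = ζ i * lam := by simp only [hq, if_pos hi]
      have : ∀ s ∈ S, v s * truncate A s q i
          = v s * (ζ i * lam) + v s * m s * (ζ i / Z) := fun s _ => by
        rw [truncate, if_pos hi, hqA, hqm, hqi]
        field_simp
      rw [Finset.sum_congr rfl this, Finset.sum_add_distrib, ← Finset.sum_mul, ← Finset.sum_mul,
        ← hD, hqi, hlam]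
      field_simp
      ring
    · have hqi : q i = x i := by simp only [hq, if_neg hi]
      have h1 : ∑ s ∈ S, v s * truncate A s q i
          = x i * ∑ s ∈ S, v s - x i * ∑ s ∈ S with x i ≤ s, v s := by
        rw [Finset.sum_filter, Finset.mul_sum, Finset.mul_sum, ← Finset.sum_sub_distrib]
        refine Finset.sum_congr rfl fun s _ => ?_
        rw [truncate, if_neg hi, hqi]
        split_ifs <;> ring
      rw [h1, ← hx i, hqi]
      ring
  have hq0 : ∀ i, 0 ≤ q i := fun i => by
    simp only [hq]
    split_ifs
    · exact mul_nonneg (hζ.1 i) hlam0.le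
    · exact hx0 i
  -- Truncation preserves total mass, so summing the equation over the arms cancels the `v`-terms
  -- and leaves U ∑ q = U.
  have hsum : ∑ i, q i = 1 := by
    have h1 := Finset.sum_congr (rfl : (Finset.univ : Finset (Fin K)) = Finset.univ)
      fun i _ => heq i
    rw [← Finset.mul_sum, Finset.sum_add_distrib, Finset.sum_congr rfl fun i _ => hmul i,
      ← Finset.mul_sum, hζ.2, Finset.sum_comm] at h1
    simp only [← Finset.mul_sum] at h1
    have ht : ∀ s, ∑ i, truncate A s q i = ∑ i, q i := fun s =>
      sum_truncate A s q (by rw [hqA]; positivity)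
    simp only [ht] at h1
    rw [← Finset.sum_mul] at h1
    have h2 : U * (∑ i, q i) = U * 1 := by linarith
    exact mul_left_cancel₀ hU.ne' h2
  refine ⟨q, ⟨hq0, hsum⟩, ?_⟩
  ext i
  simp only [Pi.smul_apply, Pi.add_apply, Finset.sum_apply, smul_eq_mul]
  rw [← heq, inv_mul_cancel_left₀ (by positivity)]

end Mixture

end MYGA

/-! ### Exponential weights -/

theorem Real.exp_neg_le_one_sub_add_sq_div_two {y : ℝ} (hy : 0 ≤ y) :
    Real.exp (-y) ≤ 1 - y + y ^ 2 / 2 := by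
  have h1 := Real.quadratic_le_exp_of_nonneg hy
  rw [Real.exp_neg, inv_le_iff_one_le_mul₀ (Real.exp_pos y)]
  have h2 : 0 ≤ 1 - y + y ^ 2 / 2 := by nlinarith [sq_nonneg (y - 1)]
  -- (1 - y + y²/2)(1 + y + y²/2) = 1 + y⁴/4.
  nlinarith [mul_le_mul_of_nonneg_left h1 h2, sq_nonneg (y ^ 2)]

namespace MYGA

/-- The potential is the logarithm of the total weight. The quadratic bound on exp(-y) holds for all
y ≥ 0, so no upper bound on the losses is needed; importance-weighted losses may be large. -/
theorem exponential_weights_regret_range {ι : Type*} [Fintype ι] [Nonempty ι] {η : ℝ} (hη : 0 < η)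
    (x : ℕ → ι → ℝ) (hx : ∀ t e, 0 ≤ x t e) (w : ℕ → ι → ℝ)
    (hw : ∀ t e, w t e = Real.exp (-η * ∑ r ∈ Finset.range t, x r e)) (T : ℕ) (e₀ : ι) :
    ∑ t ∈ Finset.range T, (∑ e, w t e * x t e) / ∑ e, w t e
        - ∑ t ∈ Finset.range T, x t e₀
      ≤ Real.log (Fintype.card ι) / η
        + η / 2 * ∑ t ∈ Finset.range T, (∑ e, w t e * x t e ^ 2) / ∑ e, w t e := by
  have hwpos : ∀ t e, 0 < w t e := fun t e => by rw [hw]; exact Real.exp_pos _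
  have hW : ∀ t, 0 < ∑ e, w t e := fun t =>
    Finset.sum_pos (fun e _ => hwpos t e) Finset.univ_nonempty
  have hstep : ∀ t, Real.log (∑ e, w (t + 1) e) ≤ Real.log (∑ e, w t e)
      - η * ((∑ e, w t e * x t e) / ∑ e, w t e)
      + η ^ 2 / 2 * ((∑ e, w t e * x t e ^ 2) / ∑ e, w t e) := fun t => by
    have h1 : ∑ e, w (t + 1) e ≤ ∑ e, w t e - η * ∑ e, w t e * x t e
        + η ^ 2 / 2 * ∑ e, w t e * x t e ^ 2 := by
      rw [Finset.mul_sum, Finset.mul_sum, ← Finset.sum_sub_distrib, ← Finset.sum_add_distrib]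
      refine Finset.sum_le_sum fun e _ => ?_
      have h2 : w (t + 1) e = w t e * Real.exp (-(η * x t e)) := by
        rw [hw, hw, Finset.sum_range_succ, ← Real.exp_add]
        ring_nf
      have h3 := Real.exp_neg_le_one_sub_add_sq_div_two (mul_nonneg hη.le (hx t e))
      rw [h2]
      nlinarith [mul_le_mul_of_nonneg_left h3 (hwpos t e).le]
    have h4 := Real.log_le_sub_one_of_pos (div_pos (hW (t + 1)) (hW t))
    rw [Real.log_div (hW _).ne' (hW _).ne'] at h4
    have h5 : (∑ e, w (t + 1) e) / ∑ e, w t e ≤ 1 - η * ((∑ e, w t e * x t e) / ∑ e, w t e)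
        + η ^ 2 / 2 * ((∑ e, w t e * x t e ^ 2) / ∑ e, w t e) := by
      rw [div_le_iff₀ (hW t)]
      have := (hW t).ne'
      field_simp
      linarith
    linarith
  have hsum : Real.log (∑ e, w T e) ≤ Real.log (Fintype.card ι)
      - η * ∑ t ∈ Finset.range T, (∑ e, w t e * x t e) / ∑ e, w t e
      + η ^ 2 / 2 * ∑ t ∈ Finset.range T, (∑ e, w t e * x t e ^ 2) / ∑ e, w t e := by
    clear e₀
    induction T with
    | zero => simp [hw]
    | succ T ih =>
      rw [Finset.sum_range_succ, Finset.sum_range_succ]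
      linarith [hstep T]
  have hlow : -η * ∑ t ∈ Finset.range T, x t e₀ ≤ Real.log (∑ e, w T e) := by
    rw [Real.le_log_iff_exp_le (hW T), ← hw]
    exact Finset.single_le_sum (fun e _ => (hwpos T e).le) (Finset.mem_univ e₀)
  rw [← mul_le_mul_iff_right₀ hη]
  field_simp
  linarith

theorem exponential_weights_regret {ι : Type*} [Fintype ι] [Nonempty ι] {η : ℝ} (hη : 0 < η)
    {T : ℕ} (x : Fin T → ι → ℝ) (hx : ∀ t e, 0 ≤ x t e) (w : Fin T → ι → ℝ)
    (hw : ∀ t e, w t e = Real.exp (-η * ∑ r ∈ Finset.Iio t, x r e)) (e₀ : ι) :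
    ∑ t, (∑ e, w t e * x t e) / ∑ e, w t e - ∑ t, x t e₀
      ≤ Real.log (Fintype.card ι) / η
        + η / 2 * ∑ t, (∑ e, w t e * x t e ^ 2) / ∑ e, w t e := by
  set y : ℕ → ι → ℝ := fun t e => if h : t < T then x ⟨t, h⟩ e else 0 with hy
  have hyx : ∀ (t : Fin T) e, y t e = x t e := fun t e => by simp [hy]
  have hwy : ∀ (t : Fin T) e, w t e = Real.exp (-η * ∑ r ∈ Finset.range t, y r e) := fun t e => by
    rw [hw, ← Nat.Iio_eq_range, ← Fin.map_valEmbedding_Iio, Finset.sum_map]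
    simp [hyx]
  have h := exponential_weights_regret_range hη y
    (fun t e => by simp only [hy]; split_ifs <;> simp [hx]) _ (fun _ _ => rfl) T e₀
  simp only [← Fin.sum_univ_eq_sum_range
    (fun t => (∑ e, Real.exp (-η * ∑ r ∈ Finset.range t, y r e) * y t e)
      / ∑ e, Real.exp (-η * ∑ r ∈ Finset.range t, y r e)) T,
    ← Fin.sum_univ_eq_sum_range (fun t => y t e₀) T,
    ← Fin.sum_univ_eq_sum_range
    (fun t => (∑ e, Real.exp (-η * ∑ r ∈ Finset.range t, y r e) * y t e ^ 2)
      / ∑ e, Real.exp (-η * ∑ r ∈ Finset.range t, y r e)) T, ← hwy, hyx] at h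
  exact h

/-! ### Weights on the thresholds -/

section Threshold

variable {T : ℕ}

theorem sum_Icc_inv_sub_inv_add {m : ℕ} (hm : 0 < m) (hmT : m ≤ T) :
    ∑ n ∈ Finset.Icc m T, (if n < T then 2 * T / (n : ℝ) - 2 * T / (n + 1 : ℝ) else 2)
      = 2 * T / m := by
  have hT : (0 : ℝ) < T := by exact_mod_cast hm.trans_le hmT
  induction hmT using Nat.decreasingInduction with
  | self =>
    rw [Finset.Icc_self, Finset.sum_singleton, if_neg (lt_irrefl _)]
    field_simp
  | of_succ k hk ih =>
    rw [← Finset.insert_Icc_add_one_left_eq_Icc hk.le, Finset.sum_insert (by simp), if_pos hk,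
      ih (Nat.succ_pos k)]
    push_cast
    ring

/-- Weights on the thresholds whose sum over the thresholds above `x` is of order `1 / x`. -/
theorem exists_threshold_weights (hT : 0 < T) {γ : ℝ} (hγ : γ ∈ grid T) :
    ∃ α : ℝ → ℝ, (∀ s ∈ thresholds T γ, 0 ≤ α s) ∧
      (∀ x, γ < x → x ≤ 1 / 2 → 1 ≤ 2 * x * ∑ s ∈ thresholds T γ with x ≤ s, α s) ∧
      (∀ x, 0 ≤ x → x * ∑ s ∈ thresholds T γ with x ≤ s, α s ≤ 1) := by
  have hT' : (0 : ℝ) < T := by exact_mod_cast hT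
  -- The threshold n/(2T) gets the n-th difference of 2T/n, and the last one gets 2 = 2T/T, so that
  -- the weights from m on telescope to exactly 2T/m; below, m = ⌈2Tx⌉.
  set β : ℕ → ℝ := fun n => if n < T then 2 * T / (n : ℝ) - 2 * T / (n + 1 : ℝ) else 2 with hβ
  have hβ0 : ∀ n, 0 < n → 0 ≤ β n := fun n hn => by
    have : (0 : ℝ) < n := by exact_mod_cast hn
    simp only [hβ]
    split_ifs
    · rw [sub_nonneg]
      gcongr
      linarith
    · norm_num
  have hinj : Function.Injective fun n : ℕ => (n : ℝ) / (2 * T) := fun n k h => by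
    have : (n : ℝ) = k := by
      have h' : (n : ℝ) / (2 * T) = k / (2 * T) := h
      field_simp at h'
      exact h'
    exact_mod_cast this
  have hfloor : ∀ n : ℕ, ⌊2 * T * ((n : ℝ) / (2 * T))⌋₊ = n := fun n => by
    rw [mul_div_cancel₀ _ (by positivity), Nat.floor_natCast]
  have hsum : ∀ x, ∑ s ∈ thresholds T γ with x ≤ s, β ⌊2 * T * s⌋₊
      = ∑ n ∈ (Finset.Icc 1 T).filter
          (fun n : ℕ => γ < (n : ℝ) / (2 * T) ∧ x ≤ (n : ℝ) / (2 * T)), β n := fun x => by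
    rw [thresholds, Finset.filter_filter, Finset.filter_image, Finset.sum_image hinj.injOn]
    simp only [hfloor]
  have hceil : ∀ (x : ℝ) (n : ℕ), x ≤ (n : ℝ) / (2 * T) ↔ ⌈2 * T * x⌉₊ ≤ n := fun x n => by
    rw [Nat.ceil_le, le_div_iff₀ (by positivity), mul_comm]
  refine ⟨fun s => β ⌊2 * T * s⌋₊, fun s hs => ?_, fun x hx hx2 => ?_, fun x hx => ?_⟩
  · simp only [thresholds, Finset.mem_filter, Finset.mem_image, Finset.mem_Icc] at hs
    obtain ⟨⟨n, ⟨hn, -⟩, rfl⟩, -⟩ := hs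
    exact (hβ0 n hn).trans_eq (congrArg β (hfloor n)).symm
  · obtain ⟨g, hg, rfl⟩ := hγ
    -- Since γ is at least one grid step, rounding up at most doubles: ⌈2Tx⌉ < 2Tx + 1 < 4Tx.
    have hx1 : 1 < 2 * T * x := by
      rw [div_lt_iff₀ (by positivity)] at hx
      have : (1 : ℝ) ≤ g := by exact_mod_cast hg
      linarith
    have hm : 0 < ⌈2 * T * x⌉₊ := Nat.ceil_pos.2 (by linarith)
    have hset : Finset.filter
        (fun n : ℕ => (g : ℝ) / (2 * T) < (n : ℝ) / (2 * T) ∧ x ≤ (n : ℝ) / (2 * T))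
        (Finset.Icc 1 T) = Finset.Icc ⌈2 * T * x⌉₊ T := by
      ext n
      rw [Finset.mem_filter, Finset.mem_Icc, Finset.mem_Icc, ← hceil]
      constructor
      · rintro ⟨⟨-, h1⟩, -, h2⟩
        exact ⟨h2, h1⟩
      · rintro ⟨h1, h2⟩
        exact ⟨⟨hm.trans_le ((hceil x n).1 h1), h2⟩, hx.trans_le h1, h1⟩
    rw [hsum, hset, sum_Icc_inv_sub_inv_add hm (Nat.ceil_le.2 (by nlinarith))]
    have hm' : (0 : ℝ) < ⌈2 * T * x⌉₊ := by exact_mod_cast hm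
    have := Nat.ceil_lt_add_one (show 0 ≤ 2 * T * x by linarith)
    rw [← mul_div_assoc, le_div_iff₀ hm']
    linarith
  · rcases hx.eq_or_lt with rfl | hx0
    · simp
    have hm : 0 < ⌈2 * T * x⌉₊ := Nat.ceil_pos.2 (by positivity)
    have hm' : (0 : ℝ) < ⌈2 * T * x⌉₊ := by exact_mod_cast hm
    have hle : ∑ n ∈ (Finset.Icc 1 T).filter
          (fun n : ℕ => γ < (n : ℝ) / (2 * T) ∧ x ≤ (n : ℝ) / (2 * T)), β n
        ≤ ∑ n ∈ Finset.Icc ⌈2 * T * x⌉₊ T, β n := by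
      refine Finset.sum_le_sum_of_subset_of_nonneg (fun n hn => ?_)
        fun n hn _ => hβ0 n (hm.trans_le (Finset.mem_Icc.1 hn).1)
      rw [Finset.mem_filter, Finset.mem_Icc, hceil] at hn
      exact Finset.mem_Icc.2 ⟨hn.2.2, hn.1.2⟩
    rw [hsum]
    refine (mul_le_mul_of_nonneg_left hle hx).trans ?_
    rcases le_or_gt ⌈2 * T * x⌉₊ T with h | h
    · rw [sum_Icc_inv_sub_inv_add hm h, ← mul_div_assoc, div_le_iff₀ hm']
      linarith [Nat.le_ceil (2 * T * x)]
    · rw [Finset.Icc_eq_empty (not_le.2 h), Finset.sum_empty, mul_zero]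
      norm_num

theorem sum_threshold_weights_le {γ : ℝ} (hγ : 0 < γ) {α : ℝ → ℝ}
    (hα : ∀ x, 0 ≤ x → x * ∑ s ∈ thresholds T γ with x ≤ s, α s ≤ 1) :
    ∑ s ∈ thresholds T γ, α s ≤ 1 / γ := by
  have h := hα γ hγ.le
  rw [Finset.filter_true_of_mem fun s hs => (Finset.mem_filter.1 hs).2.le] at h
  rw [le_div_iff₀ hγ]
  linarith

theorem card_thresholds_le (γ : ℝ) : (thresholds T γ).card ≤ T :=
  (Finset.card_filter_le _ _).trans (Finset.card_image_le.trans (by simp))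

end Threshold

/-! ### Estimates within one round -/

section Round

variable {K : ℕ} {A : Finset (Fin K)} {q l : Fin K → ℝ} {γ : ℝ}

/-- This is arm i's contribution to the conditional mean of an importance-weighted quantity:
unbiased on the arms that can be played, zero on those cut off at γ. -/
theorem truncate_mul_mul_div (hq : ∀ i, 0 ≤ q i) (hγ : 0 < γ) (hA : ∀ i ∈ A, 0 < q i)
    (g : ℝ) (i : Fin K) :
    truncate A γ q i * (g * (l i / truncate A γ q i))
      = if i ∈ A ∨ γ < q i then g * l i else 0 := by
  by_cases h : i ∈ A ∨ γ < q i
  · have : truncate A γ q i ≠ 0 := by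
      by_cases hi : i ∈ A
      · exact ((hA i hi).trans_le (le_truncate_of_mem hq hi)).ne'
      · have hi' := h.resolve_left hi
        rw [truncate, if_neg hi, if_neg (not_le.2 hi')]
        exact (hγ.trans hi').ne'
    rw [if_pos h]
    field_simp
  · rw [not_or, not_lt] at h
    rw [if_neg (by simpa [not_or] using h), truncate, if_neg h.1, if_pos h.2, zero_mul]

theorem sum_ite_mem_or (f : Fin K → ℝ) (P : Fin K → Prop) [DecidablePred P] :
    ∑ i, (if i ∈ A ∨ P i then f i else 0)
      = ∑ i ∈ A, f i + ∑ i ∈ Aᶜ, if P i then f i else 0 := by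
  rw [← Finset.sum_add_sum_compl A]
  congr 1
  · exact Finset.sum_congr rfl fun i hi => by rw [if_pos (Or.inl hi)]
  · refine Finset.sum_congr rfl fun i hi => ?_
    simp only [Finset.mem_compl.1 hi, false_or]

/-- The conditional mean of the advantage of expert s over `q`: it saves the losses of the minority
arms between γ and s and pays for the inflated majority. -/
theorem sum_truncate_mul_sub (hq : ∀ i, 0 ≤ q i) (hγ : 0 < γ) (hA : ∀ i ∈ A, 0 < q i) (s : ℝ) :
    ∑ i, truncate A γ q i * ((q i - truncate A s q i) * (l i / truncate A γ q i))
      = ∑ i ∈ Aᶜ, (if γ < q i ∧ q i ≤ s then q i * l i else 0)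
        - (∑ j with j ∉ A ∧ q j ≤ s, q j) / (∑ j ∈ A, q j) * ∑ i ∈ A, q i * l i := by
  simp only [truncate_mul_mul_div hq hγ hA]
  rw [sum_ite_mem_or, add_comm, sub_eq_add_neg, ← neg_mul, Finset.mul_sum]
  congr 1
  · refine Finset.sum_congr rfl fun i hi => ?_
    rw [truncate, if_neg (Finset.mem_compl.1 hi), ite_and]
    split_ifs <;> ring
  · refine Finset.sum_congr rfl fun i hi => ?_
    rw [truncate, if_pos hi]
    ring

theorem sum_truncate_mul_self (hq : ∀ i, 0 ≤ q i) (hγ : 0 < γ) (hA : ∀ i ∈ A, 0 < q i) :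
    ∑ i, truncate A γ q i * (q i * (l i / truncate A γ q i))
      = ∑ i ∈ A, q i * l i + ∑ i ∈ Aᶜ, if γ < q i then q i * l i else 0 := by
  simp only [truncate_mul_mul_div hq hγ hA]
  rw [sum_ite_mem_or]

theorem minority_mass_div_le (hq : ∀ i, 0 ≤ q i) (hQ : 1 / 2 ≤ ∑ j ∈ A, q j) (s : ℝ) :
    (∑ j with j ∉ A ∧ q j ≤ s, q j) / (∑ j ∈ A, q j)
      ≤ 2 * ∑ j with j ∉ A ∧ q j ≤ s, q j := by
  have h : 0 ≤ ∑ j with j ∉ A ∧ q j ≤ s, q j := Finset.sum_nonneg fun j _ => hq j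
  rw [div_le_iff₀ (by linarith)]
  nlinarith

/-- Playing the truncation only inflates the majority arms, by a factor 1 + m/q(A) with moved mass m
≤ Kγ and q(A) ≥ 1/2. -/
theorem sum_truncate_mul_le (hq : ∀ i, 0 ≤ q i) (hγ : 0 < γ) (hA : ∀ i ∈ A, 0 < q i)
    (hQ : 1 / 2 ≤ ∑ j ∈ A, q j) (hl : ∀ i, 0 ≤ l i) :
    ∑ i, truncate A γ q i * l i
      ≤ (1 + 2 * K * γ) * ∑ i, truncate A γ q i * (q i * (l i / truncate A γ q i)) := by
  have hmass : ∑ j with j ∉ A ∧ q j ≤ γ, q j ≤ K * γ := by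
    have h1 : ∑ j with j ∉ A ∧ q j ≤ γ, q j ≤ ∑ j with j ∉ A ∧ q j ≤ γ, γ :=
      Finset.sum_le_sum fun j hj => (Finset.mem_filter.1 hj).2.2
    refine h1.trans ?_
    rw [Finset.sum_const, nsmul_eq_mul]
    have : ((Finset.univ.filter fun j => j ∉ A ∧ q j ≤ γ).card : ℝ) ≤ K := by
      exact_mod_cast (Finset.card_le_univ _).trans (by simp)
    gcongr
  have hdiv := (minority_mass_div_le hq hQ γ).trans (mul_le_mul_of_nonneg_left hmass zero_le_two)
  have hX : 0 ≤ ∑ i ∈ A, q i * l i := Finset.sum_nonneg fun i _ => mul_nonneg (hq i) (hl i)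
  have hY : 0 ≤ ∑ i ∈ Aᶜ, if γ < q i then q i * l i else 0 :=
    Finset.sum_nonneg fun i _ => by
      have := mul_nonneg (hq i) (hl i)
      split_ifs <;> simp [this]
  rw [sum_truncate_mul_self hq hγ hA, ← Finset.sum_add_sum_compl A]
  have h1 : ∑ i ∈ A, truncate A γ q i * l i
      = (1 + (∑ j with j ∉ A ∧ q j ≤ γ, q j) / ∑ j ∈ A, q j) * ∑ i ∈ A, q i * l i := by
    rw [Finset.mul_sum]
    refine Finset.sum_congr rfl fun i hi => ?_
    rw [truncate, if_pos hi]
    ring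
  have h2 : ∑ i ∈ Aᶜ, truncate A γ q i * l i = ∑ i ∈ Aᶜ, if γ < q i then q i * l i else 0 := by
    refine Finset.sum_congr rfl fun i hi => ?_
    rw [truncate, if_neg (Finset.mem_compl.1 hi)]
    split_ifs <;> first | (exfalso; linarith) | ring
  rw [h1, h2, mul_add]
  have hKγ : 0 ≤ 2 * (K : ℝ) * γ := by positivity
  have h3 := mul_le_mul_of_nonneg_right hdiv hX
  nlinarith [mul_nonneg hKγ hY]

/-- After exchanging the sums, each arm contributes q(j) ∑_{s ≥ q(j)} α_s ≤ 1. -/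
theorem sum_weight_mul_minority_mass_le {S : Finset ℝ} {α : ℝ → ℝ} (hq : ∀ i, 0 ≤ q i)
    (hα : ∀ x, 0 ≤ x → x * ∑ s ∈ S with x ≤ s, α s ≤ 1) :
    ∑ s ∈ S, α s * ∑ j with j ∉ A ∧ q j ≤ s, q j ≤ K := by
  have h : ∑ s ∈ S, α s * ∑ j with j ∉ A ∧ q j ≤ s, q j
      = ∑ j, if j ∉ A then q j * ∑ s ∈ S with q j ≤ s, α s else 0 := by
    simp only [Finset.sum_filter, Finset.mul_sum]
    rw [Finset.sum_comm]
    refine Finset.sum_congr rfl fun j _ => ?_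
    split_ifs with hj
    · simp [hj]
    · exact Finset.sum_congr rfl fun s _ => by simp [hj, mul_comm]
  rw [h]
  calc _ ≤ ∑ _j : Fin K, (1 : ℝ) := Finset.sum_le_sum fun j _ => by
        split_ifs
        · exact zero_le_one
        · exact hα _ (hq j)
    _ = K := by simp

/-- The variance term of a round, bounded by the loss of the player and the advantages of the
truncated experts over the player. -/
theorem sum_truncate_mul_sq_le {S : Finset ℝ} {α : ℝ → ℝ} (hq : q ∈ stdSimplex ℝ (Fin K))
    (hγ : 0 < γ) (hA : ∀ i ∈ A, 1 / (2 * (K : ℝ)) ≤ q i) (hQ : 1 / 2 ≤ ∑ j ∈ A, q j)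
    (hl : ∀ i, l i ∈ Set.Icc (0 : ℝ) 1) (hα0 : ∀ s ∈ S, 0 ≤ α s)
    (hα1 : ∀ x, γ < x → x ≤ 1 / 2 → 1 ≤ 2 * x * ∑ s ∈ S with x ≤ s, α s)
    (hα2 : ∀ x, 0 ≤ x → x * ∑ s ∈ S with x ≤ s, α s ≤ 1) :
    ∑ i, truncate A γ q i * (q i * (l i / truncate A γ q i) ^ 2)
      ≤ 6 * K * ∑ i, truncate A γ q i * (q i * (l i / truncate A γ q i))
        + 2 * ∑ s ∈ S, α s *
          ∑ i, truncate A γ q i * ((q i - truncate A s q i) * (l i / truncate A γ q i)) := by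
  have hA0 : ∀ i ∈ A, 0 < q i := fun i hi => by
    have hK : (0 : ℝ) < K := by exact_mod_cast i.pos
    exact lt_of_lt_of_le (by positivity) (hA i hi)
  have hX : 0 ≤ ∑ i ∈ A, q i * l i :=
    Finset.sum_nonneg fun i _ => mul_nonneg (hq.1 i) (hl i).1
  have hY : 0 ≤ ∑ i ∈ Aᶜ, if γ < q i then q i * l i else 0 :=
    Finset.sum_nonneg fun i _ => by
      have := mul_nonneg (hq.1 i) (hl i).1
      split_ifs <;> simp [this]
  -- Each term is at most ℓ² ≤ ℓ, because truncation raises majority arms, and 1 ≤ 2K q(i) restores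
  -- the factor q(i).
  have hmaj : ∑ i ∈ A, truncate A γ q i * (q i * (l i / truncate A γ q i) ^ 2)
      ≤ 2 * K * ∑ i ∈ A, q i * l i := by
    rw [Finset.mul_sum]
    refine Finset.sum_le_sum fun i hi => ?_
    have hK : (0 : ℝ) < K := by exact_mod_cast i.pos
    have hle := le_truncate_of_mem (s := γ) hq.1 hi
    have hp := (hA0 i hi).trans_le hle
    have h1 : truncate A γ q i * (q i * (l i / truncate A γ q i) ^ 2)
        = q i / truncate A γ q i * l i ^ 2 := by field_simp
    have h2 : q i / truncate A γ q i ≤ 1 := (div_le_one hp).2 hle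
    have h3 := hA i hi
    rw [div_le_iff₀ (by positivity)] at h3
    have h4 := (hl i).1
    have h5 := (hl i).2
    rw [h1]
    calc _ ≤ 1 * l i ^ 2 := by gcongr
      _ ≤ 1 * l i := by nlinarith
      _ ≤ (q i * (2 * K)) * l i := by gcongr
      _ = _ := by ring
  -- Here p = q, so a term is ℓ² ≤ ℓ, and 2q(i) ∑_{s ≥ q(i)} α_s ≥ 1 restores the factor q(i). The
  -- weights reach only up to 1/2, which suffices as the whole minority has mass at most 1/2.
  have hmin : ∑ i ∈ Aᶜ, truncate A γ q i * (q i * (l i / truncate A γ q i) ^ 2)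
      ≤ 2 * ∑ s ∈ S, α s * ∑ i ∈ Aᶜ, if γ < q i ∧ q i ≤ s then q i * l i else 0 := by
    have hswap : 2 * ∑ s ∈ S, α s * ∑ i ∈ Aᶜ, (if γ < q i ∧ q i ≤ s then q i * l i else 0)
        = ∑ i ∈ Aᶜ, if γ < q i then 2 * q i * (∑ s ∈ S with q i ≤ s, α s) * l i else 0 := by
      simp only [Finset.sum_filter, Finset.mul_sum, Finset.sum_mul]
      rw [Finset.sum_comm]
      refine Finset.sum_congr rfl fun i _ => ?_
      split_ifs with hi
      · refine Finset.sum_congr rfl fun s _ => ?_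
        simp only [hi, true_and]
        split_ifs <;> ring
      · simp [hi]
    rw [hswap]
    refine Finset.sum_le_sum fun i hi => ?_
    rw [Finset.mem_compl] at hi
    have h4 := (hl i).1
    have h5 := (hl i).2
    rw [truncate, if_neg hi]
    by_cases hγi : q i ≤ γ
    · rw [if_pos hγi, if_neg (not_lt.2 hγi), zero_mul]
    · rw [if_neg hγi, if_pos (not_le.1 hγi)]
      have hqi : 0 < q i := hγ.trans (not_le.1 hγi)
      have hhalf : q i ≤ 1 / 2 := by
        have h6 : q i ≤ ∑ j ∈ Aᶜ, q j :=
          Finset.single_le_sum (fun j _ => hq.1 j) (Finset.mem_compl.2 hi)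
        have h7 := Finset.sum_add_sum_compl A q
        rw [hq.2] at h7
        linarith
      have h8 := hα1 _ (not_le.1 hγi) hhalf
      calc q i * (q i * (l i / q i) ^ 2) = l i ^ 2 := by field_simp
        _ ≤ 1 * l i := by nlinarith
        _ ≤ _ := by gcongr
  -- The inflation costs at most 2 m_s times the majority loss. Summed against 2α_s this gives 4K,
  -- which with the 2K of `hmaj` makes the constant 6K.
  have hD : ∀ s ∈ S, α s * ∑ i ∈ Aᶜ, (if γ < q i ∧ q i ≤ s then q i * l i else 0)
      ≤ α s * ∑ i, truncate A γ q i * ((q i - truncate A s q i) * (l i / truncate A γ q i))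
        + 2 * (∑ i ∈ A, q i * l i) * (α s * ∑ j with j ∉ A ∧ q j ≤ s, q j) := fun s hs => by
    rw [sum_truncate_mul_sub hq.1 hγ hA0]
    have h := mul_le_mul_of_nonneg_right (minority_mass_div_le hq.1 hQ s) hX
    have := mul_le_mul_of_nonneg_left h (hα0 s hs)
    linarith
  have hD' := Finset.sum_le_sum hD
  rw [Finset.sum_add_distrib, ← Finset.mul_sum] at hD'
  have hmass := mul_le_mul_of_nonneg_left (sum_weight_mul_minority_mass_le (A := A) hq.1 hα2) hX
  rw [← Finset.sum_add_sum_compl A, sum_truncate_mul_self hq.1 hγ hA0]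
  have hKY : 0 ≤ (K : ℝ) * ∑ i ∈ Aᶜ, (if γ < q i then q i * l i else 0) := by positivity
  linarith

end Round

end MYGA

/-! ### Expectations over the actions -/

namespace BanditGame

variable {Ω : Type*} [m : MeasurableSpace Ω] {μ : Measure Ω} {E : Type*} {K T : ℕ}
  (G : BanditGame μ E K T)

theorem dotProduct_lossEstimator (t : Fin T) (ω : Ω) (x : Fin K → ℝ) :
    dotProduct x (G.lossEstimator t ω)
      = x (G.action t ω) * (G.loss t ω (G.action t ω) / G.play t ω (G.action t ω)) := by
  simp [dotProduct, lossEstimator]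

/-- The estimator is biased only downward, and only on arms of probability zero. -/
theorem play_mul_mul_loss_div_play_le (x : ℝ) (hx : 0 ≤ x) (t : Fin T) (ω : Ω) (i : Fin K) :
    G.play t ω i * (x * (G.loss t ω i / G.play t ω i)) ≤ x * G.loss t ω i := by
  by_cases h0 : G.play t ω i = 0
  · rw [h0, zero_mul]
    exact mul_nonneg hx (G.loss_mem t ω i).1
  · exact le_of_eq (by field_simp)

/-- A bounded family of random vectors whose member `t` is known before the action of round `t`. -/
structure IsPredictable (F : Fin T → Ω → Fin K → ℝ) : Prop where
  measurable : ∀ t i, Measurable[G.info t] fun ω => F t ω i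
  bounded : ∃ C, ∀ t ω i, |F t ω i| ≤ C

variable {G}

namespace IsPredictable

variable {F F' : Fin T → Ω → Fin K → ℝ}

theorem mul (hF : G.IsPredictable F) (hF' : G.IsPredictable F') :
    G.IsPredictable fun t ω i => F t ω i * F' t ω i := by
  obtain ⟨C, hC⟩ := hF.bounded
  obtain ⟨C', hC'⟩ := hF'.bounded
  refine ⟨fun t i => (hF.measurable t i).mul (hF'.measurable t i), C * C', fun t ω i => ?_⟩
  rw [abs_mul]
  exact mul_le_mul (hC t ω i) (hC' t ω i) (abs_nonneg _) ((abs_nonneg _).trans (hC t ω i))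

theorem sub (hF : G.IsPredictable F) (hF' : G.IsPredictable F') :
    G.IsPredictable fun t ω i => F t ω i - F' t ω i := by
  obtain ⟨C, hC⟩ := hF.bounded
  obtain ⟨C', hC'⟩ := hF'.bounded
  exact ⟨fun t i => (hF.measurable t i).sub (hF'.measurable t i), C + C', fun t ω i =>
    (abs_sub _ _).trans (add_le_add (hC t ω i) (hC' t ω i))⟩

theorem of_mem_stdSimplex (hF : ∀ t i, Measurable[G.info t] fun ω => F t ω i)
    (hs : ∀ t ω, F t ω ∈ stdSimplex ℝ (Fin K)) : G.IsPredictable F :=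
  ⟨hF, 1, fun t ω i => by
    rw [abs_of_nonneg ((hs t ω).1 i), ← (hs t ω).2]
    exact Finset.single_le_sum (fun j _ => (hs t ω).1 j) (Finset.mem_univ i)⟩

theorem integrable_apply [IsFiniteMeasure μ] (hF : G.IsPredictable F) (t : Fin T) (i : Fin K) :
    Integrable (fun ω => F t ω i) μ := by
  obtain ⟨C, hC⟩ := hF.bounded
  exact Integrable.of_bound ((hF.measurable t i).mono (G.info.le t) le_rfl).aestronglyMeasurable C
    (.of_forall fun ω => hC t ω i)

theorem integrable_sum [IsFiniteMeasure μ] (hF : G.IsPredictable F) :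
    Integrable (fun ω => ∑ t, ∑ i, F t ω i) μ :=
  integrable_finsetSum _ fun t _ => integrable_finsetSum _ fun i _ => hF.integrable_apply t i

end IsPredictable

theorem isPredictable_play : G.IsPredictable G.play :=
  .of_mem_stdSimplex (fun t i => (measurable_pi_apply i).comp (G.measurable_play t)) G.play_mem

theorem isPredictable_loss : G.IsPredictable G.loss :=
  ⟨fun t i => (measurable_pi_apply i).comp (G.measurable_loss t), 1, fun t ω i => by
    rw [abs_of_nonneg (G.loss_mem t ω i).1]
    exact (G.loss_mem t ω i).2⟩

theorem isPredictable_advice (e : E) : G.IsPredictable fun t => G.advice t e :=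
  .of_mem_stdSimplex (fun t i => (measurable_pi_apply i).comp (G.measurable_advice t e))
    fun t ω => G.advice_mem t e ω

theorem apply_action_eq_sum (F : Fin T → Ω → Fin K → ℝ) (t : Fin T) (ω : Ω) :
    F t ω (G.action t ω)
      = ∑ i, F t ω i * Set.indicator {ω | G.action t ω = i} (fun _ => (1 : ℝ)) ω := by
  simp [Set.indicator_apply]

namespace IsPredictable

variable {F : Fin T → Ω → Fin K → ℝ} [IsFiniteMeasure μ]

theorem integrable_indicator (hF : G.IsPredictable F) (t : Fin T) (i : Fin K) :
    Integrable (fun ω => F t ω i * Set.indicator {ω | G.action t ω = i} (fun _ => (1 : ℝ)) ω) μ :=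
  (hF.integrable_apply t i).mul_bdd (c := 1)
    ((measurable_const.indicator
      (G.measurable_action t (measurableSet_singleton i))).aestronglyMeasurable)
    (.of_forall fun ω => by
      by_cases h : G.action t ω = i <;> simp [h])

theorem integrable_sum_action (hF : G.IsPredictable F) :
    Integrable (fun ω => ∑ t, F t ω (G.action t ω)) μ := by
  simp only [apply_action_eq_sum F]
  exact integrable_finsetSum _ fun t _ => integrable_finsetSum _ fun i _ =>
    hF.integrable_indicator t i

/-- The expectation over the actions may be taken conditionally on the past of each round. -/
theorem integral_sum_action (hF : G.IsPredictable F) :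
    ∫ ω, ∑ t, F t ω (G.action t ω) ∂μ = ∫ ω, ∑ t, ∑ i, G.play t ω i * F t ω i ∂μ := by
  have hpF := isPredictable_play.mul hF
  simp only [apply_action_eq_sum F]
  rw [integral_finsetSum _ fun t _ => integrable_finsetSum _ fun i _ =>
      hF.integrable_indicator t i,
    integral_finsetSum _ fun t _ => integrable_finsetSum _ fun i _ => hpF.integrable_apply t i]
  refine Finset.sum_congr rfl fun t _ => ?_
  rw [integral_finsetSum _ fun i _ => hF.integrable_indicator t i,
    integral_finsetSum _ fun i _ => hpF.integrable_apply t i]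
  refine Finset.sum_congr rfl fun i _ => ?_
  have hind : Integrable (Set.indicator {ω | G.action t ω = i} (fun _ => (1 : ℝ))) μ :=
    (integrable_const _).indicator (G.measurable_action t (measurableSet_singleton i))
  have h1 := condExp_mul_of_stronglyMeasurable_left (m := G.info t)
    (hF.measurable t i).stronglyMeasurable (hF.integrable_indicator t i) hind
  rw [← integral_condExp (G.info.le t)]
  refine integral_congr_ae ?_
  filter_upwards [h1, G.action_law t i] with ω h2 h3
  refine h2.trans ?_
  rw [Pi.mul_apply, h3, mul_comm]

end IsPredictable

theorem measurable_lossEstimator {r t : Fin T} (hrt : r < t) (i : Fin K) :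
    Measurable[G.info t] fun ω => G.lossEstimator r ω i := by
  have hle := G.info.mono hrt.le
  have hset : MeasurableSet[G.info t] {ω | i = G.action r ω} := by
    have := G.measurable_past_action r t hrt (measurableSet_singleton i)
    convert this using 1
    ext ω
    simp [eq_comm]
  exact Measurable.ite hset
    (((isPredictable_loss.measurable r i).div (isPredictable_play.measurable r i)).mono hle le_rfl)
    measurable_const

theorem measurable_expWeight (η : ℝ) {ξ : Fin T → Ω → Fin K → ℝ}
    (hξ : ∀ t i, Measurable[G.info t] fun ω => ξ t ω i) (t : Fin T) :
    Measurable[G.info t] fun ω => G.expWeight η ξ t ω := by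
  refine Measurable.exp (Measurable.const_mul (Finset.measurable_sum _ fun r hr =>
    Finset.measurable_sum _ fun i _ => ?_) _)
  rw [Finset.mem_Iio] at hr
  exact ((hξ r i).mono (G.info.mono hr.le) le_rfl).mul (measurable_lossEstimator hr i)

theorem expWeight_pos (η : ℝ) (ξ : Fin T → Ω → Fin K → ℝ) (t : Fin T) (ω : Ω) :
    0 < G.expWeight η ξ t ω := Real.exp_pos _

end BanditGame

/-! ### Analysis of a run -/

namespace MYGA

open BanditGame

theorem measurable_truncate {Ω : Type*} {_ : MeasurableSpace Ω} {K : ℕ} {A : Ω → Finset (Fin K)}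
    {q : Ω → Fin K → ℝ} (hA : ∀ i, MeasurableSet {ω | i ∈ A ω})
    (hq : ∀ i, Measurable fun ω => q ω i) (s : ℝ) (i : Fin K) :
    Measurable fun ω => truncate (A ω) s (q ω) i := by
  have hle : ∀ j, MeasurableSet {ω | q ω j ≤ s} := fun j =>
    measurableSet_le (hq j) measurable_const
  have h1 : Measurable fun ω => ∑ j with j ∉ A ω ∧ q ω j ≤ s, q ω j := by
    simp only [Finset.sum_filter]
    exact Finset.measurable_sum _ fun j _ =>
      Measurable.ite ((hA j).compl.inter (hle j)) (hq j) measurable_const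
  have h2 : Measurable fun ω => ∑ j ∈ A ω, q ω j := by
    have : ∀ ω, ∑ j ∈ A ω, q ω j = ∑ j, if j ∈ A ω then q ω j else 0 := fun ω => by simp
    simp only [this]
    exact Finset.measurable_sum _ fun j _ => Measurable.ite (hA j) (hq j) measurable_const
  exact Measurable.ite (hA i) ((hq i).mul ((h1.div h2).const_add 1))
    (Measurable.ite (hle i) measurable_const (hq i))

/-- A description without the pivot, whose measurability is not part of `IsRun`. -/
theorem mem_majority_iff {K : ℕ} {σ : Equiv.Perm (Fin K)} {ζ : Fin K → ℝ} {k : Fin K}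
    (hk : IsPivot σ ζ k) (i : Fin K) :
    i ∈ majority σ k ↔ ∀ j, 1 / 2 ≤ ∑ j' ∈ Finset.Iic j, ζ (σ j') → σ.symm i ≤ j := by
  simp only [majority, Finset.mem_filter, Finset.mem_univ, true_and]
  exact ⟨fun h j hj => h.trans (hk.2 hj), fun h => h k hk.1⟩

namespace IsRun

variable {Ω : Type*} [m : MeasurableSpace Ω] {μ : Measure Ω} {E : Type*} [Fintype E] {K T : ℕ}
  {G : BanditGame μ E K T} {η γ : ℝ} {order : Fin T → Ω → Equiv.Perm (Fin K)}
  {pivot : Fin T → Ω → Fin K} {q : Fin T → Ω → Fin K → ℝ}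

theorem gamma_pos (h : IsRun G η γ order pivot q) (hT : 0 < T) : 0 < γ := by
  obtain ⟨n, hn, rfl⟩ := h.gamma_mem
  have : (0 : ℝ) < n := by exact_mod_cast hn
  have : (0 : ℝ) < T := by exact_mod_cast hT
  positivity

theorem measurableSet_mem_majority (h : IsRun G η γ order pivot q) (t : Fin T) (i : Fin K) :
    MeasurableSet[G.info t] {ω | i ∈ majority (order t ω) (pivot t ω)} := by
  have hw : ∀ e, Measurable[G.info t] fun ω => G.expWeight η (fun r => G.advice r e) t ω :=
    fun e => measurable_expWeight η (isPredictable_advice e).measurable t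
  have hζ : ∀ i, Measurable[G.info t] fun ω => weightedAverage
      (fun e => G.expWeight η (fun r => G.advice r e) t ω) (fun e => G.advice t e ω) i :=
    fun i => by
    simp only [weightedAverage, Pi.smul_apply, Finset.sum_apply, smul_eq_mul]
    exact (Finset.measurable_sum _ fun e _ => hw e).inv.mul (Finset.measurable_sum _ fun e _ =>
      (hw e).mul ((isPredictable_advice e).measurable t i))
  have hset : {ω | i ∈ majority (order t ω) (pivot t ω)}
      = ⋃ σ : Equiv.Perm (Fin K), {ω | order t ω = σ} ∩ ⋂ j : Fin K,
        {ω | 1 / 2 ≤ ∑ j' ∈ Finset.Iic j, weightedAverage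
          (fun e => G.expWeight η (fun r => G.advice r e) t ω) (fun e => G.advice t e ω) (σ j') →
            σ.symm i ≤ j} := by
    ext ω
    simp only [Set.mem_ofPred_eq, Set.mem_iUnion, Set.mem_inter_iff, Set.mem_iInter]
    rw [mem_majority_iff (h.isPivot t ω)]
    constructor
    · exact fun hj => ⟨_, rfl, hj⟩
    · rintro ⟨_, rfl, hj⟩
      exact hj
  rw [hset]
  refine MeasurableSet.iUnion fun σ => (h.measurable_order t σ).inter
    (MeasurableSet.iInter fun j => ?_)
  exact MeasurableSet.imp (measurableSet_le measurable_const
    (Finset.measurable_sum _ fun j' _ => hζ (σ j'))) (MeasurableSet.const _)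

theorem isPredictable_q (h : IsRun G η γ order pivot q) : G.IsPredictable q :=
  .of_mem_stdSimplex (fun t i => (measurable_pi_apply i).comp (h.measurable_q t))
    fun t ω => (h.isMixture t ω).1

variable [Nonempty E]

theorem weight_sum_pos (t : Fin T) (ω : Ω) :
    0 < ∑ e, G.expWeight η (fun r => G.advice r e) t ω :=
  Finset.sum_pos (fun _ _ => expWeight_pos _ _ _ _) Finset.univ_nonempty

theorem le_of_mem_majority (h : IsRun G η γ order pivot q) (t : Fin T) (ω : Ω) {i : Fin K}
    (hi : i ∈ majority (order t ω) (pivot t ω)) : 1 / (2 * (K : ℝ)) ≤ q t ω i :=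
  (inv_le_of_mem_majority (weightedAverage_mem_stdSimplex (fun _ => (expWeight_pos _ _ _ _).le)
    (weight_sum_pos t ω) fun e => G.advice_mem t e ω) (h.sorts t ω) (h.isPivot t ω) hi).trans
    (weightedAverage_le_mixture (h.isMixture t ω) (weight_sum_pos t ω)
      (fun _ _ => (expWeight_pos _ _ _ _).le) hi)

theorem half_le_sum_majority (h : IsRun G η γ order pivot q) (t : Fin T) (ω : Ω) :
    1 / 2 ≤ ∑ i ∈ majority (order t ω) (pivot t ω), q t ω i := by
  have h1 := (h.isPivot t ω).1
  rw [Set.mem_ofPred_eq, ← sum_majority] at h1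
  exact h1.trans (Finset.sum_le_sum fun i hi =>
    weightedAverage_le_mixture (h.isMixture t ω) (weight_sum_pos t ω)
      (fun _ _ => (expWeight_pos _ _ _ _).le) hi)

theorem truncate_mem (h : IsRun G η γ order pivot q) (s : ℝ) (t : Fin T) (ω : Ω) :
    truncate (majority (order t ω) (pivot t ω)) s (q t ω) ∈ stdSimplex ℝ (Fin K) :=
  truncate_mem_stdSimplex s (h.isMixture t ω).1 (by linarith [h.half_le_sum_majority t ω])

theorem isPredictable_truncate (h : IsRun G η γ order pivot q) (s : ℝ) :
    G.IsPredictable fun t ω => truncate (majority (order t ω) (pivot t ω)) s (q t ω) :=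
  .of_mem_stdSimplex (fun t i =>
    measurable_truncate (h.measurableSet_mem_majority t) (h.isPredictable_q.measurable t) s i)
    (h.truncate_mem s)

/-- A played arm has probability at least 1/(2K) in the majority and above γ in the minority; where
the probability is zero, the quotient is zero by convention. -/
theorem isPredictable_loss_div_play (h : IsRun G η γ order pivot q) (hT : 0 < T) :
    G.IsPredictable fun t ω i => G.loss t ω i / G.play t ω i := by
  have hγ := h.gamma_pos hT
  refine ⟨fun t i => (isPredictable_loss.measurable t i).div (isPredictable_play.measurable t i),
    2 * K + 1 / γ, fun t ω i => ?_⟩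
  have hl := G.loss_mem t ω i
  have hp := (G.play_mem t ω).1 i
  have hK : (0 : ℝ) < K := by exact_mod_cast i.pos
  have hp' : G.play t ω i = 0 ∨ 1 ≤ (2 * K + 1 / γ) * G.play t ω i := by
    rw [h.play_eq]
    by_cases hi : i ∈ majority (order t ω) (pivot t ω)
    · right
      have h1 := (h.le_of_mem_majority t ω hi).trans
        (le_truncate_of_mem (s := γ) (h.isMixture t ω).1.1 hi)
      rw [div_le_iff₀ (by positivity)] at h1
      have h2 := truncate_nonneg (A := majority (order t ω) (pivot t ω)) (s := γ)
        (h.isMixture t ω).1.1 i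
      have : 0 ≤ 1 / γ * truncate (majority (order t ω) (pivot t ω)) γ (q t ω) i := by positivity
      linarith
    · rw [truncate, if_neg hi]
      split_ifs with hq
      · exact Or.inl rfl
      · right
        rw [not_le] at hq
        have h1 : 1 ≤ 1 / γ * q t ω i := by
          rw [div_mul_eq_mul_div, le_div_iff₀ hγ]
          linarith
        have : 0 ≤ 2 * K * q t ω i := by
          have := hγ.trans hq
          positivity
        linarith
  rw [abs_of_nonneg (div_nonneg hl.1 hp)]
  rcases hp' with h0 | h1
  · rw [h0, div_zero]
    positivity
  · rcases hp.eq_or_lt with h0 | h0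
    · rw [← h0] at h1
      linarith
    · rw [div_le_iff₀ h0]
      exact hl.2.trans h1

/-- The advices of the experts together with those of the auxiliary experts. -/
noncomputable def _root_.BanditGame.allAdvice (G : BanditGame μ E K T) (γ : ℝ)
    (order : Fin T → Ω → Equiv.Perm (Fin K)) (pivot : Fin T → Ω → Fin K)
    (q : Fin T → Ω → Fin K → ℝ) : E ⊕ thresholds T γ → Fin T → Ω → Fin K → ℝ :=
  Sum.elim (fun e t => G.advice t e)
    fun s t ω => truncate (majority (order t ω) (pivot t ω)) s (q t ω)

theorem allAdvice_mem (h : IsRun G η γ order pivot q) (e : E ⊕ thresholds T γ) (t : Fin T)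
    (ω : Ω) : G.allAdvice γ order pivot q e t ω ∈ stdSimplex ℝ (Fin K) := by
  rcases e with e | s
  · exact G.advice_mem t e ω
  · exact h.truncate_mem s t ω

theorem isPredictable_allAdvice (h : IsRun G η γ order pivot q) (e : E ⊕ thresholds T γ) :
    G.IsPredictable (G.allAdvice γ order pivot q e) := by
  rcases e with e | s
  · exact isPredictable_advice e
  · exact h.isPredictable_truncate s

theorem sum_expWeight_mul_allAdvice (h : IsRun G η γ order pivot q) (t : Fin T) (ω : Ω)
    (i : Fin K) :
    ∑ e, G.expWeight η (G.allAdvice γ order pivot q e) t ω * G.allAdvice γ order pivot q e t ω i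
      = (∑ e, G.expWeight η (G.allAdvice γ order pivot q e) t ω) * q t ω i := by
  have h1 := mixture_apply (h.isMixture t ω) (add_pos_of_pos_of_nonneg (weight_sum_pos t ω)
    (Finset.sum_nonneg fun _ _ => (expWeight_pos _ _ _ _).le)).ne' i
  rw [Fintype.sum_sum_type, Fintype.sum_sum_type]
  simp only [allAdvice, Sum.elim_inl, Sum.elim_inr]
  rw [Finset.sum_coe_sort (thresholds T γ) fun s => G.expWeight η
      (fun t ω => truncate (majority (order t ω) (pivot t ω)) s (q t ω)) t ω
        * truncate (majority (order t ω) (pivot t ω)) s (q t ω) i,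
    Finset.sum_coe_sort (thresholds T γ) fun s => G.expWeight η
      (fun t ω => truncate (majority (order t ω) (pivot t ω)) s (q t ω)) t ω]
  exact h1.symm

/-- Exponential weights along a single trajectory. The mean advice at the drawn arm is `q`, and ξ² ≤
ξ bounds the second moment by the same mean. -/
theorem sum_action_le (h : IsRun G η γ order pivot q) (e₀ : E ⊕ thresholds T γ)
    (ω : Ω) :
    ∑ t, (q t ω (G.action t ω) - G.allAdvice γ order pivot q e₀ t ω (G.action t ω)) *
        (G.loss t ω (G.action t ω) / G.play t ω (G.action t ω))
      ≤ Real.log (Fintype.card E + T) / η + η / 2 * ∑ t, q t ω (G.action t ω) *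
        ((G.loss t ω (G.action t ω) / G.play t ω (G.action t ω)) *
          (G.loss t ω (G.action t ω) / G.play t ω (G.action t ω))) := by
  set ξ := G.allAdvice γ order pivot q
  set y : Fin T → ℝ := fun t => G.loss t ω (G.action t ω) / G.play t ω (G.action t ω) with hy
  have hy0 : ∀ t, 0 ≤ y t := fun t =>
    div_nonneg (G.loss_mem t ω _).1 ((G.play_mem t ω).1 _)
  have hξ0 : ∀ e t i, 0 ≤ ξ e t ω i := fun e t i => (h.allAdvice_mem e t ω).1 i
  have hξ1 : ∀ e t i, ξ e t ω i ≤ 1 := fun e t i => by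
    rw [← (h.allAdvice_mem e t ω).2]
    exact Finset.single_le_sum (fun j _ => hξ0 e t j) (Finset.mem_univ i)
  have hW : ∀ t, 0 < ∑ e, G.expWeight η (ξ e) t ω := fun t =>
    Finset.sum_pos (fun _ _ => expWeight_pos _ _ _ _) Finset.univ_nonempty
  have hmix : ∀ t i, ∑ e, G.expWeight η (ξ e) t ω * ξ e t ω i
      = (∑ e, G.expWeight η (ξ e) t ω) * q t ω i := fun t i =>
    h.sum_expWeight_mul_allAdvice t ω i
  have hreg := exponential_weights_regret h.eta_pos (fun t e => ξ e t ω (G.action t ω) * y t)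
    (fun t e => mul_nonneg (hξ0 _ _ _) (hy0 t)) (fun t e => G.expWeight η (ξ e) t ω)
    (fun t e => by simp only [expWeight, dotProduct_lossEstimator, hy]) e₀
  have h1 : ∀ t, (∑ e, G.expWeight η (ξ e) t ω * (ξ e t ω (G.action t ω) * y t))
      / ∑ e, G.expWeight η (ξ e) t ω = q t ω (G.action t ω) * y t := fun t => by
    simp only [← mul_assoc]
    rw [← Finset.sum_mul, hmix]
    have := (hW t).ne'
    field_simp
  have h2 : ∀ t, (∑ e, G.expWeight η (ξ e) t ω * (ξ e t ω (G.action t ω) * y t) ^ 2)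
      / ∑ e, G.expWeight η (ξ e) t ω ≤ q t ω (G.action t ω) * (y t * y t) := fun t => by
    rw [div_le_iff₀ (hW t)]
    calc _ ≤ ∑ e, G.expWeight η (ξ e) t ω * ξ e t ω (G.action t ω) * (y t * y t) := by
          refine Finset.sum_le_sum fun e _ => ?_
          rw [mul_assoc]
          refine mul_le_mul_of_nonneg_left ?_ (expWeight_pos _ _ _ _).le
          rw [mul_pow, ← sq]
          have h5 := hξ0 e t (G.action t ω)
          have h6 := hξ1 e t (G.action t ω)
          exact mul_le_mul_of_nonneg_right (by nlinarith) (sq_nonneg _)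
      _ = _ := by
          rw [← Finset.sum_mul, hmix]
          ring
  have h3 : Real.log (Fintype.card (E ⊕ thresholds T γ)) ≤ Real.log (Fintype.card E + T) := by
    have hle : Fintype.card (E ⊕ thresholds T γ) ≤ Fintype.card E + T := by
      rw [Fintype.card_sum, Fintype.card_coe]
      exact Nat.add_le_add_left (card_thresholds_le γ) _
    exact Real.log_le_log (by exact_mod_cast Fintype.card_pos) (by exact_mod_cast hle)
  simp only [h1] at hreg
  have h4 := Finset.sum_le_sum fun t (_ : t ∈ Finset.univ) => h2 t
  have hη := h.eta_pos
  simp only [sub_mul, Finset.sum_sub_distrib]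
  calc _ ≤ _ := hreg
    _ ≤ _ := by gcongr

/-- Z is the expected estimated loss of `q` and R the common bound on the expected estimated regret
against all experts. R is bounded through Z and Z through R; the two are separated when the learning
rate is tuned. -/
theorem exists_regret_le [IsProbabilityMeasure μ] (h : IsRun G η γ order pivot q) (hT : 0 < T)
    (hηγ : 2 * η ≤ γ) :
    ∃ Z R : ℝ, 0 ≤ Z ∧ Z ≤ T ∧ G.regret ≤ R + 2 * K * γ * Z ∧ Z ≤ G.bestExpertLoss + R ∧
      R ≤ 2 * (Real.log (Fintype.card E + T) / η) + 6 * (η * K) * Z := by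
  have hγ := h.gamma_pos hT
  have hη := h.eta_pos
  obtain ⟨α, hα0, hα1, hα2⟩ := exists_threshold_weights hT h.gamma_mem
  set ξ := G.allAdvice γ order pivot q
  set y : Fin T → Ω → Fin K → ℝ := fun t ω i => G.loss t ω i / G.play t ω i with hy
  have hpy : G.IsPredictable y := h.isPredictable_loss_div_play hT
  have hpq := h.isPredictable_q
  have hZ := hpq.mul hpy
  have hV := hpq.mul (hpy.mul hpy)
  have hD : ∀ e, G.IsPredictable fun t ω i => (q t ω i - ξ e t ω i) * y t ω i :=
    fun e => (hpq.sub (h.isPredictable_allAdvice e)).mul hpy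
  have hZ' := isPredictable_play.mul hZ
  have hV' := isPredictable_play.mul hV
  have hD' := fun e => isPredictable_play.mul (hD e)
  have hdot : ∀ e, Integrable (fun ω => ∑ t, dotProduct (G.advice t e ω) (G.loss t ω)) μ :=
    fun e => ((isPredictable_advice e).mul isPredictable_loss).integrable_sum
  have hq0 : ∀ t ω i, 0 ≤ q t ω i := fun t ω i => (h.isMixture t ω).1.1 i
  have hp0 : ∀ t ω i, 0 ≤ G.play t ω i := fun t ω i => (G.play_mem t ω).1 i
  have hl0 : ∀ t ω i, 0 ≤ G.loss t ω i := fun t ω i => (G.loss_mem t ω i).1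
  have hy0 : ∀ t ω i, 0 ≤ y t ω i := fun t ω i => div_nonneg (hl0 t ω i) (hp0 t ω i)
  have hA0 : ∀ t ω, ∀ i ∈ majority (order t ω) (pivot t ω), 0 < q t ω i := fun t ω i hi => by
    have hK : (0 : ℝ) < K := by exact_mod_cast i.pos
    exact lt_of_lt_of_le (by positivity) (h.le_of_mem_majority t ω hi)
  set Z := ∫ ω, ∑ t, ∑ i, G.play t ω i * (q t ω i * y t ω i) ∂μ with hZdef
  set V := ∫ ω, ∑ t, ∑ i, G.play t ω i * (q t ω i * (y t ω i * y t ω i)) ∂μ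
  set D : E ⊕ thresholds T γ → ℝ :=
    fun e => ∫ ω, ∑ t, ∑ i, G.play t ω i * ((q t ω i - ξ e t ω i) * y t ω i) ∂μ
  set Lg := Real.log (Fintype.card E + T)
  set R := Lg / η + η / 2 * V with hR
  have hDR : ∀ e, D e ≤ R := fun e => by
    have h1 : ∫ ω, ∑ t, (q t ω (G.action t ω) - ξ e t ω (G.action t ω)) * y t ω (G.action t ω) ∂μ
        ≤ ∫ ω, (Lg / η + η / 2 * ∑ t, q t ω (G.action t ω) *
          (y t ω (G.action t ω) * y t ω (G.action t ω))) ∂μ :=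
      integral_mono (hD e).integrable_sum_action
        ((integrable_const _).add (hV.integrable_sum_action.const_mul _))
        fun ω => h.sum_action_le e ω
    rw [integral_add (integrable_const _) (hV.integrable_sum_action.const_mul _),
      integral_const_mul, hV.integral_sum_action, (hD e).integral_sum_action] at h1
    simpa using h1
  have hV0 : 0 ≤ V := integral_nonneg fun ω => Finset.sum_nonneg fun t _ =>
    Finset.sum_nonneg fun i _ =>
      mul_nonneg (hp0 t ω i) (mul_nonneg (hq0 t ω i) (mul_self_nonneg _))
  have hZ0 : 0 ≤ Z := integral_nonneg fun ω => Finset.sum_nonneg fun t _ =>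
    Finset.sum_nonneg fun i _ =>
      mul_nonneg (hp0 t ω i) (mul_nonneg (hq0 t ω i) (hy0 t ω i))
  have hLg : 0 ≤ Lg := Real.log_nonneg (by
    have : (1 : ℝ) ≤ Fintype.card E := by exact_mod_cast Fintype.card_pos
    have : (0 : ℝ) ≤ T := by positivity
    linarith)
  have hR0 : 0 ≤ R := by positivity
  have hZT : Z ≤ T := by
    have h1 : Z ≤ ∫ _ω, (T : ℝ) ∂μ := by
      refine integral_mono hZ'.integrable_sum (integrable_const _) fun ω => ?_
      calc ∑ t, ∑ i, G.play t ω i * (q t ω i * y t ω i) ≤ ∑ _t : Fin T, (1 : ℝ) := by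
            refine Finset.sum_le_sum fun t _ => ?_
            rw [← (h.isMixture t ω).1.2]
            exact Finset.sum_le_sum fun i _ => (G.play_mul_mul_loss_div_play_le _ (hq0 t ω i) t ω i).trans
              (mul_le_of_le_one_right (hq0 t ω i) (G.loss_mem t ω i).2)
        _ = T := by simp
    simpa using h1
  have hVle : V ≤ 6 * K * Z + 2 * ∑ s ∈ (thresholds T γ).attach, α s * D (Sum.inr s) := by
    have hint : ∀ s ∈ (thresholds T γ).attach, Integrable (fun ω => α s * ∑ t, ∑ i,
        G.play t ω i * ((q t ω i - ξ (Sum.inr s) t ω i) * y t ω i)) μ := fun s _ =>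
      (hD' (Sum.inr s)).integrable_sum.const_mul _
    calc V ≤ ∫ ω, (6 * K * ∑ t, ∑ i, G.play t ω i * (q t ω i * y t ω i)
          + 2 * ∑ s ∈ (thresholds T γ).attach, α s * ∑ t, ∑ i,
            G.play t ω i * ((q t ω i - ξ (Sum.inr s) t ω i) * y t ω i)) ∂μ := by
          refine integral_mono hV'.integrable_sum ((hZ'.integrable_sum.const_mul _).add
            ((integrable_finsetSum _ hint).const_mul _)) fun ω => ?_
          have hround := Finset.sum_le_sum fun t (_ : t ∈ Finset.univ) =>
            sum_truncate_mul_sq_le (h.isMixture t ω).1 hγ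
              (fun i hi => h.le_of_mem_majority t ω hi) (h.half_le_sum_majority t ω)
              (G.loss_mem t ω) hα0 hα1 hα2
          simp only [← h.play_eq] at hround
          simp only [sq] at hround
          refine hround.trans_eq ?_
          rw [Finset.sum_add_distrib, ← Finset.mul_sum, ← Finset.mul_sum]
          congr 2
          rw [Finset.sum_comm, ← Finset.sum_attach (thresholds T γ)]
          refine Finset.sum_congr rfl fun s _ => ?_
          rw [Finset.mul_sum]
          rfl
      _ = _ := by
          rw [integral_add (hZ'.integrable_sum.const_mul _)
            ((integrable_finsetSum _ hint).const_mul _), integral_const_mul, integral_const_mul,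
            integral_finsetSum _ hint]
          simp only [integral_const_mul]
          rfl
  -- The auxiliary experts enter here: each advantage `D (Sum.inr s)` is itself at most R.
  have hVR : V ≤ 6 * K * Z + 2 * (1 / γ * R) := by
    refine hVle.trans ?_
    have h1 : ∑ s ∈ (thresholds T γ).attach, α s * D (Sum.inr s) ≤ 1 / γ * R := by
      calc _ ≤ ∑ s ∈ (thresholds T γ).attach, α s * R :=
            Finset.sum_le_sum fun s _ => mul_le_mul_of_nonneg_left (hDR _) (hα0 s s.2)
        _ = (∑ s ∈ thresholds T γ, α s) * R := by
            rw [← Finset.sum_mul, Finset.sum_attach (thresholds T γ) α]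
        _ ≤ _ := mul_le_mul_of_nonneg_right (sum_threshold_weights_le hγ hα2) hR0
    linarith
  -- V reintroduces R with coefficient η/γ ≤ 1/2, which moves to the left side and doubles the other
  -- terms.
  have hRle : R ≤ 2 * (Lg / η) + 6 * (η * K) * Z := by
    have h1 : η / γ ≤ 1 / 2 := by
      rw [div_le_div_iff₀ hγ two_pos]
      linarith
    have h2 : η / 2 * V ≤ 3 * (η * K) * Z + η / γ * R := by
      refine (mul_le_mul_of_nonneg_left hVR (by positivity)).trans_eq ?_
      field_simp
      ring
    have h3 := mul_le_mul_of_nonneg_right h1 hR0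
    linarith
  have hZe : ∀ e, Z ≤ ∫ ω, ∑ t, dotProduct (G.advice t e ω) (G.loss t ω) ∂μ + R := fun e => by
    have h1 : Z ≤ ∫ ω, (∑ t, dotProduct (G.advice t e ω) (G.loss t ω) +
        ∑ t, ∑ i, G.play t ω i * ((q t ω i - ξ (Sum.inl e) t ω i) * y t ω i)) ∂μ := by
      refine integral_mono hZ'.integrable_sum
        ((hdot e).add (hD' (Sum.inl e)).integrable_sum) fun ω => ?_
      simp only [← Finset.sum_add_distrib, dotProduct]
      refine Finset.sum_le_sum fun t _ => Finset.sum_le_sum fun i _ => ?_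
      have := G.play_mul_mul_loss_div_play_le _ ((G.advice_mem t e ω).1 i) t ω i
      have hee : ξ (Sum.inl e) t ω i = G.advice t e ω i := rfl
      rw [hee]
      simp only [hy] at this ⊢
      linarith
    rw [integral_add (hdot e) (hD' (Sum.inl e)).integrable_sum] at h1
    linarith [hDR (Sum.inl e)]
  have hloss : ∫ ω, ∑ t, G.loss t ω (G.action t ω) ∂μ ≤ (1 + 2 * K * γ) * Z := by
    rw [isPredictable_loss.integral_sum_action, hZdef, ← integral_const_mul]
    refine integral_mono (isPredictable_play.mul isPredictable_loss).integrable_sum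
      (hZ'.integrable_sum.const_mul _) fun ω => ?_
    simp only [Finset.mul_sum (Finset.univ : Finset (Fin T))]
    refine Finset.sum_le_sum fun t _ => ?_
    have := sum_truncate_mul_le (h.isMixture t ω).1.1 hγ (hA0 t ω) (h.half_le_sum_majority t ω)
      (hl0 t ω)
    simpa only [← h.play_eq] using this
  have hbest : Z ≤ G.bestExpertLoss + R := by
    obtain ⟨e, he⟩ := exists_eq_ciInf_of_finite
      (f := fun e : E => ∫ ω, ∑ t, dotProduct (G.advice t e ω) (G.loss t ω) ∂μ)
    rw [bestExpertLoss, ← he]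
    exact hZe e
  refine ⟨Z, R, hZ0, hZT, ciSup_le fun e => ?_, hbest, hRle⟩
  simp only [Finset.sum_sub_distrib]
  rw [integral_sub (isPredictable_loss (G := G)).integrable_sum_action (hdot e)]
  have := hZe e
  linarith

end IsRun

end MYGA

/-! ### Tuning and conclusion -/

namespace BanditGame

theorem bestExpertLoss_nonneg {Ω : Type*} [MeasurableSpace Ω] {μ : Measure Ω} {E : Type*}
    {K T : ℕ} (G : BanditGame μ E K T) : 0 ≤ G.bestExpertLoss :=
  Real.iInf_nonneg fun e => integral_nonneg fun ω => Finset.sum_nonneg fun t _ =>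
    Finset.sum_nonneg fun i _ => mul_nonneg ((G.advice_mem t e ω).1 i) (G.loss_mem t ω i).1

theorem arms_pos {Ω : Type*} [MeasurableSpace Ω] {μ : Measure Ω} [IsProbabilityMeasure μ]
    {E : Type*} {K T : ℕ} (G : BanditGame μ E K T) (hT : 0 < T) : 0 < K := by
  obtain ⟨ω⟩ := μ.nonempty_of_neZero
  exact (G.action ⟨0, hT⟩ ω).pos

end BanditGame

namespace MYGA

variable {K N T : ℕ} {L : ℝ}

theorem rateScale_pos (hK : 0 < K) (hN : 0 < Real.log (N * T)) (hL : 0 ≤ L) :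
    0 < rateScale K N T L := by
  have hK' : (0 : ℝ) < K := by exact_mod_cast hK
  unfold rateScale
  split_ifs with h
  · positivity
  · have : 0 < L := lt_of_le_of_ne hL (Ne.symm h)
    exact lt_min (by positivity) (Real.sqrt_pos.2 (by positivity))

theorem rateScale_mul_arms_le_one (hK : 0 < K) : rateScale K N T L * K ≤ 1 := by
  have hK' : (0 : ℝ) < K := by exact_mod_cast hK
  rw [← le_div_iff₀ hK', rateScale]
  split_ifs
  · exact le_rfl
  · exact min_le_left _ _

theorem log_le_rateScale_mul (hK : 0 < K) (hN : 0 < Real.log (N * T)) (hL : 0 ≤ L) :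
    Real.log (N * T)
      ≤ rateScale K N T L * (√(K * Real.log (N * T) * L) + K * Real.log (N * T)) := by
  have hK' : (0 : ℝ) < K := by exact_mod_cast hK
  have h1 : Real.log (N * T) ≤ 1 / K * (√(K * Real.log (N * T) * L) + K * Real.log (N * T)) := by
    rw [mul_add, ← mul_assoc, one_div_mul_cancel hK'.ne', one_mul]
    exact le_add_of_nonneg_left (by positivity)
  unfold rateScale
  split_ifs with h
  · exact h1
  · have hL' : 0 < L := lt_of_le_of_ne hL (Ne.symm h)
    rcases min_choice (1 / (K : ℝ)) (√(Real.log (N * T) / (K * L))) with h2 | h2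
    · rwa [h2]
    · rw [h2, mul_add, ← Real.sqrt_mul (by positivity)]
      have h3 : Real.log (N * T) / (K * L) * (K * Real.log (N * T) * L)
          = Real.log (N * T) ^ 2 := by field_simp
      rw [h3, Real.sqrt_sq hN.le]
      exact le_add_of_nonneg_right (by positivity)

theorem rateScale_mul_arms_mul_le (hK : 0 < K) (hN : 0 < Real.log (N * T)) (hL : 0 ≤ L) :
    rateScale K N T L * K * L ≤ √(K * Real.log (N * T) * L) + K * Real.log (N * T) := by
  have hK' : (0 : ℝ) < K := by exact_mod_cast hK
  rcases hL.eq_or_lt with rfl | hL'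
  · rw [mul_zero]
    positivity
  rw [rateScale, if_neg hL'.ne', mul_assoc]
  calc _ ≤ √(Real.log (N * T) / (K * L)) * (K * L) := by
        gcongr
        exact min_le_right _ _
    _ = √(K * Real.log (N * T) * L) := by
        nth_rw 2 [← Real.sqrt_sq (show 0 ≤ (K : ℝ) * L by positivity)]
        rw [← Real.sqrt_mul (by positivity)]
        congr 1
        field_simp
    _ ≤ _ := le_add_of_nonneg_right (by positivity)

/-- The auxiliary experts, at most T of them, only double the logarithm: n + t ≤ nt + 1 ≤ (nt)². -/
theorem log_add_le_two_mul_log {n t : ℕ} (h : 1 < n * t) :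
    Real.log (n + t) ≤ 2 * Real.log (n * t) := by
  have hn : 1 ≤ n := Nat.pos_of_ne_zero fun h0 => by simp [h0] at h
  have ht : 1 ≤ t := Nat.pos_of_ne_zero fun h0 => by simp [h0] at h
  have h1 : n + t ≤ (n * t) ^ 2 := by
    obtain ⟨n, rfl⟩ := Nat.exists_eq_add_of_le' hn
    obtain ⟨t, rfl⟩ := Nat.exists_eq_add_of_le' ht
    nlinarith
  have h2 : ((n : ℝ) + t) ≤ (n * t) ^ 2 := by exact_mod_cast h1
  have h3 : (0 : ℝ) < n + t := by positivity
  calc _ ≤ Real.log ((n * t) ^ 2) := Real.log_le_log h3 h2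
    _ = _ := by rw [Real.log_pow]; norm_num

/-- P stands for the bound of the theorem without its constant. The scale ρ satisfies log/ρ ≤ P and
ρKL ≤ P, so the terms log/η and ηKL are both O(P). -/
theorem regret_le_of_rate {a b d η γ ρ k lN lg L Lmin P Z R reg : ℝ} {T : ℝ} (hT : 0 < T)
    (ha : 0 < a) (hb : 0 < b) (hb12 : 12 * b ≤ 1) (hd : 0 ≤ d) (hk : 0 < k) (hρ : 0 < ρ)
    (hlN : 1 / 2 ≤ lN) (hlg : lg ≤ 2 * lN) (hρk : ρ * k ≤ 1) (hlNP : lN ≤ ρ * P)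
    (hρL : ρ * k * L ≤ P) (hkP : k * lN ≤ P) (haη : a * ρ ≤ η) (hηb : η ≤ b * ρ)
    (hγ : γ ≤ d * η + 1 / (2 * T)) (hZ : 0 ≤ Z) (hZT : Z ≤ T) (hL : Lmin ≤ L)
    (hreg : reg ≤ R + 2 * k * γ * Z) (hZR : Z ≤ Lmin + R)
    (hR : R ≤ 2 * (lg / η) + 6 * (η * k) * Z) :
    reg ≤ (4 / a + (6 + 2 * d) * (2 * b + 8 * b / a) + 2) * P := by
  have hη : 0 < η := lt_of_lt_of_le (by positivity) haη
  have hP : 0 ≤ P := le_trans (by positivity) hkP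
  have hηk : η * k ≤ b := by
    calc η * k ≤ b * ρ * k := by gcongr
      _ = b * (ρ * k) := by ring
      _ ≤ b * 1 := by gcongr
      _ = b := mul_one b
  have hlgη : lg / η ≤ 2 * (lN / η) := by
    rw [← mul_div_assoc]
    gcongr
  have hlNη : lN / η ≤ P / a := by
    rw [div_le_div_iff₀ hη ha]
    calc lN * a ≤ ρ * P * a := by gcongr
      _ = P * (a * ρ) := by ring
      _ ≤ P * η := by gcongr
  have hηkL : η * k * L ≤ b * P := by
    rcases le_or_gt 0 L with hL0 | hL0
    · calc η * k * L ≤ b * ρ * k * L := by gcongr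
        _ = b * (ρ * k * L) := by ring
        _ ≤ b * P := by gcongr
    · have : η * k * L ≤ 0 := mul_nonpos_of_nonneg_of_nonpos (by positivity) hL0.le
      exact this.trans (by positivity)
  have hZhalf : 6 * (η * k) * Z ≤ 1 / 2 * Z := by
    gcongr
    linarith
  -- Inserting the bound on R into Z ≤ Lmin + R leaves Z/2 on the right, to be absorbed.
  have hZle : Z ≤ 2 * L + 8 * (lN / η) := by linarith
  have hηkZ : η * k * Z ≤ (2 * b + 8 * b / a) * P := by
    calc η * k * Z ≤ η * k * (2 * L + 8 * (lN / η)) := by gcongr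
      _ = 2 * (η * k * L) + 8 * (η * k * (lN / η)) := by ring
      _ ≤ 2 * (b * P) + 8 * (b * (P / a)) := by
          gcongr
      _ = _ := by ring
  -- The grid step 1/(2T) in γ costs only k, because Z ≤ T; and k ≤ 2P because the logarithm is at
  -- least 1/2.
  have hkγ : 2 * k * γ * Z ≤ 2 * d * (η * k * Z) + k := by
    calc 2 * k * γ * Z ≤ 2 * k * (d * η + 1 / (2 * T)) * Z := by gcongr
      _ = 2 * d * (η * k * Z) + k * (Z / T) := by field_simp
      _ ≤ 2 * d * (η * k * Z) + k * 1 := by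
          gcongr
          exact (div_le_one hT).2 hZT
      _ = _ := by ring
  have hk2 : k ≤ 2 * P := by nlinarith
  have h1 := mul_le_mul_of_nonneg_left hηkZ (show 0 ≤ 6 + 2 * d by positivity)
  calc reg ≤ 4 * (P / a) + (6 + 2 * d) * (η * k * Z) + 2 * P := by linarith
    _ ≤ 4 * (P / a) + (6 + 2 * d) * ((2 * b + 8 * b / a) * P) + 2 * P := by linarith
    _ = _ := by ring

end MYGA

theorem theorem1 :
    -- the implicit equation that the algorithm has to solve in each round always has a solution
    (∀ (K T : ℕ) (E : Type*) [Fintype E] [Nonempty E] (γ : ℝ) (u : E → ℝ) (v : ℝ → ℝ)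
      (ξ : E → Fin K → ℝ) (σ : Equiv.Perm (Fin K)) (k : Fin K),
      γ ∈ MYGA.grid T → (∀ e, 0 < u e) → (∀ s ∈ MYGA.thresholds T γ, 0 < v s) →
      (∀ e, ξ e ∈ stdSimplex ℝ (Fin K)) →
      MYGA.Sorts σ (MYGA.weightedAverage u ξ) → MYGA.IsPivot σ (MYGA.weightedAverage u ξ) k →
      ∃ q, MYGA.IsMixture u ξ (MYGA.thresholds T γ) v (MYGA.majority σ k) q) ∧
    -- the regret bound
    ∃ c₀ κ : ℝ, 0 < c₀ ∧ 0 < κ ∧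
      ∀ a b c d : ℝ, 0 < a → a ≤ b → c₀ ≤ c → c ≤ d → b * d ≤ κ →
      ∃ C : ℝ, 0 < C ∧
        ∀ (K T : ℕ) (E : Type*) [Fintype E] [Nonempty E]
          (Ω : Type*) [MeasurableSpace Ω] (μ : Measure Ω) [IsProbabilityMeasure μ]
          (G : BanditGame μ E K T) (Lstar η γ : ℝ)
          (order : Fin T → Ω → Equiv.Perm (Fin K)) (pivot : Fin T → Ω → Fin K)
          (q : Fin T → Ω → Fin K → ℝ),
          1 < Fintype.card E * T →
          G.bestExpertLoss ≤ Lstar →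
          a * MYGA.rateScale K (Fintype.card E) T Lstar ≤ η →
          η ≤ b * MYGA.rateScale K (Fintype.card E) T Lstar →
          c * η ≤ γ → γ ≤ d * η + 1 / (2 * T) →
          MYGA.IsRun G η γ order pivot q →
          G.regret ≤ C * (√(K * Real.log (Fintype.card E * T) * Lstar)
            + K * Real.log (Fintype.card E * T)) := by
  -- c₀ = 2 gives η/γ ≤ 1/2. As d ≥ c ≥ 2, κ = 1/6 forces b ≤ 1/12, hence 6ηK ≤ 1/2; these are the
  -- two absorptions.
  refine ⟨fun K T E _ _ γ u v ξ σ k _ hu hv hξ _ hk => ?_, 2, 1 / 6, two_pos, by norm_num,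
    fun a b c d ha hab hc hcd hbd => ⟨4 / a + (6 + 2 * d) * (2 * b + 8 * b / a) + 2, ?_, ?_⟩⟩
  · have h := hk.1
    rw [Set.mem_ofPred_eq, ← MYGA.sum_majority] at h
    exact MYGA.exists_isMixture _ v _ hu hv hξ (by linarith)
  · have hb : 0 < b := ha.trans_le hab
    have hd : 0 < d := by linarith
    positivity
  · intro K T E _ _ Ω _ μ _ G L η γ order pivot q hET hL haη hηb hcη hγ hrun
    have hb : 0 < b := ha.trans_le hab
    have hd : 2 ≤ d := hc.trans hcd
    have hT : 0 < T := Nat.pos_of_ne_zero fun h0 => by simp [h0] at hET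
    have hK := G.arms_pos hT
    have hlog : 1 / 2 ≤ Real.log (Fintype.card E * T) := by
      have h2 : (2 : ℝ) ≤ Fintype.card E * T := by exact_mod_cast hET
      linarith [Real.log_two_gt_d9, Real.log_le_log two_pos h2]
    have hlog0 : 0 < Real.log (Fintype.card E * T) := by linarith
    have hL0 : 0 ≤ L := G.bestExpertLoss_nonneg.trans hL
    have hηγ : 2 * η ≤ γ := le_trans (mul_le_mul_of_nonneg_right hc hrun.eta_pos.le) hcη
    obtain ⟨Z, R, hZ0, hZT, hreg, hbest, hR⟩ := hrun.exists_regret_le hT hηγ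
    exact MYGA.regret_le_of_rate (by exact_mod_cast hT) ha hb (by nlinarith) (by linarith)
      (by exact_mod_cast hK) (MYGA.rateScale_pos hK hlog0 hL0) hlog
      (MYGA.log_add_le_two_mul_log hET) (MYGA.rateScale_mul_arms_le_one hK)
      (MYGA.log_le_rateScale_mul hK hlog0 hL0) (MYGA.rateScale_mul_arms_mul_le hK hlog0 hL0)
      (le_add_of_nonneg_left (Real.sqrt_nonneg _)) haη hηb hγ hZ0 hZT hL hreg hbest hR
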